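/- Let $G$ be the complex orthogonal group $O_N$, or the complex symplectic group $Sp_N$ with $N=2M$ even. Index the standard basis of $\mathbb C^N$ by $i\in\{-M,\dots,-1,1,\dots,M\}$ if $N=2M$ and by $i\in\{-M,\dots,M\}$ if $N=2M+1$. Realize $G$ as the group preserving the form $\langle e_i,e_j\rangle=\delta_{i,-j}$ (orthogonal case) or $\langle e_i,e_j\rangle=\delta_{i,-j}\operatorname{sgn} i$ (symplectic case), and let $\mathfrak g\subset\mathfrak{gl}_N$ be its Lie algebra. Put $\varepsilon_{ij}=1$, $\eta=\tfrac12$ in the orthogonal case and $\varepsilon_{ij}=\operatorname{sgn} i\cdot\operatorname{sgn} j$, $\eta=-\tfrac12$ in the symplectic case. Let $E_{ij}$ be the matrix units and $F_{ij}=E_{ij}-\varepsilon_{ij}E_{-j,-i}\in\mathfrak g$, also regarded as elements of the universal enveloping algebra $\mathrm U(\mathfrak g)$. Define $$F(u)=-u-\eta+\sum_{i,j}E_{ij}\otimes F_{ji},\qquad Q=\sum_{i,j}\varepsilon_{ij}\,E_{ij}\otimes E_{-i,-j},\qquad \tilde R(u,v)=1+\frac{Q}{u+v}.$$ For fixed $n$,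 let $F_p(u)\in\operatorname{End}(\mathbb C^N)^{\otimes n}\otimes\mathrm U(\mathfrak g)[u]$ be the image of $F(u)$ when $\operatorname{End}(\mathbb C^N)$ is embedded as the $p$-th tensor factor of $\operatorname{End}(\mathbb C^N)^{\otimes n}$, and let $X_{qp}$ be the image of $X\in\operatorname{End}(\mathbb C^N)^{\otimes2}$ when its first and second tensor factors are embedded as the $q$-th and $p$-th ones. Let $\nu$ be a partition of $n$ with at most $N$ parts and let $T$ be a standard tableau of shape $\nu$. Let $c_p$ be the content (column number minus row number) of the box of $T$ containing $p$. Let $W_\nu$ be the irreducible $S_n$-module corresponding to $\nu$, with an $S_n$-invariant inner product, and let $w_T\in W_\nu$ be a unit vector of the Young basis corresponding to $T$: for every $p\le n$ it lies in an irreducible $S_p$-submodule corresponding to the shape formed by the entries $1,\dots,p$ of $T$. Let $Y_T\in\operatorname{End}(\mathbb C^N)^{\otimes n}$ be the operator by which $$\frac{\dim W_\nu}{n!}\sum_{\sigma\in S_n}\langle w_T,\sigma w_T\rangle\,\sigma\in\mathbb C S_n$$ acts in $(\mathbb C^N)^{\otimes n}$ through permutations of the tensor factors. In all products below the noncommuting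 factors are arranged from left to right as the index increases. Define the element of $\operatorname{End}(\mathbb C^N)^{\otimes n}\otimes\mathrm U(\mathfrak g)(u)$ $$F_T(u)=(Y_T\otimes1)\cdot\prod_{p=1}^{n}\Bigl(1+\frac{Q_{1p}\otimes1+\dots+Q_{p-1,p}\otimes1}{2u+c_p}\Bigr)F_p(u+c_p).$$ **Proposition.** In $\operatorname{End}(\mathbb C^N)^{\otimes n}\otimes\mathrm U(\mathfrak g)(u)$, $$F_T(u)=(Y_T\otimes1)\cdot\prod_{p=1}^{n}\Bigl(\ \prod_{q=1}^{p-1}\tilde R_{qp}(u+c_q,u+c_p)\otimes1\Bigr)F_p(u+c_p).$$ -/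

import Mathlib

open scoped TensorProduct

/-! ### Standard tableaux, irreducible modules of the symmetric group, Young vectors -/

/-- A standard tableau of shape `ν` with entries `0, …, n - 1` (which stand for `1, …, n`): a
bijection between entries and boxes such that entries increase along rows and down columns.
A box is a pair (row, column). The bijection forces `n` to be the number of boxes of `ν`. -/
structure StandardTableau (ν : YoungDiagram) (n : ℕ) where
  /-- the box that an entry occupies -/
  box : Fin n ≃ {x : ℕ × ℕ // x ∈ ν.cells}
  row_increasing : ∀ p q : Fin n, (box p).1.1 = (box q).1.1 → (box p).1.2 < (box q).1.2 → p < q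
  col_increasing : ∀ p q : Fin n, (box p).1.2 = (box q).1.2 → (box p).1.1 < (box q).1.1 → p < q

namespace StandardTableau

variable {ν : YoungDiagram} {n : ℕ}

/-- The content (column minus row) of the box that the entry `p` occupies. -/
def content (T : StandardTableau ν n) (p : Fin n) : ℤ :=
  ((T.box p).1.2 : ℤ) - ((T.box p).1.1 : ℤ)

theorem le_of_box_le (T : StandardTableau ν n) (p q : Fin n)
    (h : (T.box p).1 ≤ (T.box q).1) : p ≤ q := by
  obtain ⟨h1, h2⟩ := Prod.le_def.1 h
  have hm : ((T.box p).1.1, (T.box q).1.2) ∈ ν.cells :=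
    ν.up_left_mem (i2 := (T.box q).1.1) (j2 := (T.box q).1.2) h1 le_rfl (T.box q).2
  obtain ⟨r, hr⟩ := T.box.surjective ⟨_, hm⟩
  have hr1 : (T.box r).1.1 = (T.box p).1.1 := by rw [hr]
  have hr2 : (T.box r).1.2 = (T.box q).1.2 := by rw [hr]
  have a : p ≤ r := by
    rcases h2.eq_or_lt with e | l
    · exact (T.box.injective (Subtype.ext (Prod.ext hr1.symm (e.trans hr2.symm)))).le
    · exact (T.row_increasing p r hr1.symm (hr2 ▸ l)).le
  have b : r ≤ q := by
    rcases h1.eq_or_lt with e | l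
    · exact (T.box.injective (Subtype.ext (Prod.ext (hr1.trans e) hr2))).le
    · exact (T.col_increasing r q hr2 (hr1 ▸ l)).le
  exact a.trans b

/-- The shape of the tableau obtained from `T` by removing all but the first `p` entries. -/
def shape (T : StandardTableau ν n) (p : ℕ) : YoungDiagram where
  cells := (Finset.univ.filter fun q : Fin n => (q : ℕ) < p).image fun q => (T.box q).1
  isLowerSet := by
    intro a b hba ha
    simp only [Finset.coe_image, Finset.coe_filter, Finset.mem_univ, true_and, Set.mem_image,
      Set.mem_ofPred_eq] at ha ⊢
    obtain ⟨q, hq, rfl⟩ := ha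
    obtain ⟨r, hr⟩ := T.box.surjective ⟨b, ν.isLowerSet hba (T.box q).2⟩
    refine ⟨r, lt_of_le_of_lt ?_ hq, by rw [hr]⟩
    exact T.le_of_box_le r q (by rw [hr]; exact hba)

end StandardTableau

/-- The Young symmetrizer of a (not necessarily standard) filling `t` of the diagram `ω`: the sum
of all permutations preserving the rows of `t` times the signed sum of all permutations
preserving the columns of `t`. -/
noncomputable def youngSymmetrizer {ω : YoungDiagram} {p : ℕ}
    (t : Fin p ≃ {x : ℕ × ℕ // x ∈ ω.cells}) : MonoidAlgebra ℂ (Equiv.Perm (Fin p)) :=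
  (∑ σ : Equiv.Perm (Fin p) with ∀ q, (t (σ q)).1.1 = (t q).1.1, MonoidAlgebra.single σ 1) *
  (∑ σ : Equiv.Perm (Fin p) with ∀ q, (t (σ q)).1.2 = (t q).1.2,
    MonoidAlgebra.single σ ((Equiv.Perm.sign σ : ℤ) : ℂ))

/-- The left ideal of the group ring generated by the Young symmetrizer of a filling of `ω`, with
the symmetric group acting by left multiplication: the irreducible module corresponding to `ω`
(for a one-row diagram it is the trivial module). -/
noncomputable def spechtRep {ω : YoungDiagram} {p : ℕ}
    (t : Fin p ≃ {x : ℕ × ℕ // x ∈ ω.cells}) :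
    Representation ℂ (Equiv.Perm (Fin p))
      (Ideal.span {youngSymmetrizer t} : Ideal (MonoidAlgebra ℂ (Equiv.Perm (Fin p)))) :=
  Representation.ofModule' _

/-- `ρ` is an irreducible representation of the symmetric group corresponding to the
partition `ω` of `p`. -/
def IsIrrepOfShape {p : ℕ} {W : Type*} [AddCommGroup W] [Module ℂ W]
    (ρ : Representation ℂ (Equiv.Perm (Fin p)) W) (ω : YoungDiagram) : Prop :=
  ∃ t : Fin p ≃ {x : ℕ × ℕ // x ∈ ω.cells}, Nonempty ((spechtRep t).Equiv ρ)

/-- The restriction of a representation of `S_n` to the subgroup `S_p` of the permutations of the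
first `p` points. -/
noncomputable def restrictFirst {n p : ℕ} (hp : p ≤ n) {W : Type*} [AddCommGroup W] [Module ℂ W]
    (ρ : Representation ℂ (Equiv.Perm (Fin n)) W) : Representation ℂ (Equiv.Perm (Fin p)) W :=
  ρ.comp (Equiv.Perm.viaEmbeddingHom (Fin.castLEEmb hp))

/-- `w` is a unit vector spanning the line `W_T`: for every `p`, it lies in an irreducible
`S_p`-submodule which corresponds to the shape of the first `p` entries of `T`. -/
def IsYoungVector {ν : YoungDiagram} {n : ℕ} (T : StandardTableau ν n)
    {W : Type*} [NormedAddCommGroup W] [InnerProductSpace ℂ W]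
    (ρ : Representation ℂ (Equiv.Perm (Fin n)) W) (w : W) : Prop :=
  ‖w‖ = 1 ∧ ∀ (p : ℕ) (hp : p ≤ n), ∃ U : Subrepresentation (restrictFirst hp ρ),
    w ∈ U ∧ IsIrrepOfShape U.toRepresentation (T.shape p)

/-- The normalized diagonal matrix element
`(dim W / n!) ∑_σ ⟨w, σ w⟩ σ` in the group ring of `S_n`. -/
noncomputable def diagonalMatrixElement {n : ℕ} {W : Type*} [NormedAddCommGroup W]
    [InnerProductSpace ℂ W] (ρ : Representation ℂ (Equiv.Perm (Fin n)) W) (w : W) :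
    MonoidAlgebra ℂ (Equiv.Perm (Fin n)) :=
  ∑ σ : Equiv.Perm (Fin n),
    MonoidAlgebra.single σ (((Module.finrank ℂ W : ℂ) / (n.factorial : ℂ)) * inner ℂ w (ρ σ w))

/-! ### Tensor powers of a matrix algebra

`End(ℂ^I)^{⊗ n} ⊗ R` is realized as the algebra of matrices over `R` whose rows and columns are
indexed by `Fin n → I`, the standard basis of `(ℂ^I)^{⊗ n}`. -/

section TensorPowers

variable {I R : Type*} [Fintype I] [DecidableEq I] {n : ℕ}

/-- The permutation of tensor factors
`v_0 ⊗ ⋯ ⊗ v_{n-1} ↦ v_{σ⁻¹ 0} ⊗ ⋯ ⊗ v_{σ⁻¹ (n-1)}`, as a homomorphism of monoids. -/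
def permuteFactors (I : Type*) [Fintype I] [DecidableEq I] (n : ℕ) :
    Equiv.Perm (Fin n) →* Matrix (Fin n → I) (Fin n → I) ℂ where
  toFun σ := Matrix.of fun i j => if i = j ∘ σ.symm then 1 else 0
  map_one' := by
    ext i j
    simp [Matrix.one_apply, Equiv.Perm.one_def]
  map_mul' σ τ := by
    ext i j
    simp [Matrix.mul_apply, Equiv.Perm.mul_def, Function.comp_assoc]
    rfl

/-- The embedding `ι_p ⊗ id` of `End(ℂ^I) ⊗ R` as the `p`-th tensor factor. -/
def leg [Zero R] (p : Fin n) (X : Matrix I I R) : Matrix (Fin n → I) (Fin n → I) R :=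
  Matrix.of fun i j => if ∀ r, r ≠ p → i r = j r then X (i p) (j p) else 0

/-- `X_{pq} = (ι_p ⊗ ι_q)(X)` for `p ≠ q` and `X` in `End(ℂ^I)^{⊗ 2}`. -/
def leg₂ [Zero R] (p q : Fin n) (X : Matrix (I × I) (I × I) R) :
    Matrix (Fin n → I) (Fin n → I) R :=
  Matrix.of fun i j =>
    if ∀ r, r ≠ p → r ≠ q → i r = j r then X (i p, i q) (j p, j q) else 0

end TensorPowers

/-! ### Orthogonal and symplectic Lie algebras -/

attribute [local instance 100] LieRing.ofAssociativeRing

/-- The two series of groups: `O N` is the orthogonal group `O_N` and `Sp M` the symplectic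
group `Sp_{2M}`. -/
inductive ClassicalGroup
  | O (N : ℕ)
  | Sp (M : ℕ)

namespace ClassicalGroup

/-- The dimension `N` of the defining representation. -/
def dim : ClassicalGroup → ℕ
  | O N => N
  | Sp M => 2 * M

/-- The index set `{-M, …, -1, 1, …, M}` if `N = 2M`, or `{-M, …, M}` if `N = 2M + 1`. -/
noncomputable abbrev Idx (G : ClassicalGroup) : Type :=
  {k : ℤ // k ∈ (Finset.Icc (-((G.dim / 2 : ℕ) : ℤ)) ((G.dim / 2 : ℕ) : ℤ)).filter
    fun k => k ≠ 0 ∨ Odd G.dim}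

noncomputable instance (G : ClassicalGroup) : Neg G.Idx where
  neg i := ⟨-i.1, by
    have h := i.2
    simp only [Finset.mem_filter, Finset.mem_Icc] at h ⊢
    obtain ⟨⟨h1, h2⟩, h3⟩ := h
    exact ⟨⟨by omega, by omega⟩, by simpa using h3⟩⟩

/-- `sgn i` in the symplectic case and `1` in the orthogonal case. -/
noncomputable def sgn : (G : ClassicalGroup) → G.Idx → ℂ
  | O _, _ => 1
  | Sp _, i => ((Int.sign i.1 : ℤ) : ℂ)

/-- `ε_ij`, which is `sgn i · sgn j` in the symplectic case and `1` in the orthogonal case. -/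
noncomputable def eps (G : ClassicalGroup) (i j : G.Idx) : ℂ := G.sgn i * G.sgn j

/-- The Gram matrix of the bilinear form: `⟨e_i, e_j⟩ = δ_{i,-j}` in the orthogonal case and
`⟨e_i, e_j⟩ = δ_{i,-j} · sgn i` in the symplectic case. -/
noncomputable def form (G : ClassicalGroup) : Matrix G.Idx G.Idx ℂ :=
  Matrix.of fun i j => if i = -j then G.sgn i else 0

/-- The Lie algebra of `G`: all matrices that are skew-adjoint with respect to the form. -/
noncomputable abbrev lie (G : ClassicalGroup) : LieSubalgebra ℂ (Matrix G.Idx G.Idx ℂ) :=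
  skewAdjointMatricesLieSubalgebra G.form

/-- `F_ij = E_ij - ε_ij E_{-j,-i}` as a matrix. -/
noncomputable def FMatrix (G : ClassicalGroup) (i j : G.Idx) : Matrix G.Idx G.Idx ℂ :=
  Matrix.single i j 1 - G.eps i j • Matrix.single (-j) (-i) 1

theorem neg_neg_idx (G : ClassicalGroup) (i : G.Idx) : -(-i) = i := Subtype.ext (neg_neg i.1)

theorem sgn_mul_self (G : ClassicalGroup) (i : G.Idx) : G.sgn i * G.sgn i = 1 := by
  cases G with
  | O N => simp [sgn]
  | Sp M =>
    have h0 : i.1 ≠ 0 := by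
      rcases (Finset.mem_filter.1 i.2).2 with h | h
      · exact h
      · exact absurd h (by simp [dim])
    rcases lt_or_gt_of_ne h0 with h | h
    · simp [sgn, Int.sign_eq_neg_one_of_neg h]
    · simp [sgn, Int.sign_eq_one_of_pos h]

theorem sgn_neg_mul (G : ClassicalGroup) (i j : G.Idx) :
    G.sgn (-i) * G.sgn (-j) = G.sgn i * G.sgn j := by
  cases G with
  | O N => simp [sgn]
  | Sp M =>
    have h : ∀ k : (Sp M).Idx, (-k).1 = -k.1 := fun _ => rfl
    simp [sgn, h, Int.sign_neg]

theorem sgn_neg_cancel (G : ClassicalGroup) (i j : G.Idx) :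
    G.sgn i * G.sgn j * G.sgn (-j) = G.sgn (-i) := by
  have h := G.sgn_neg_mul i j
  rw [← h, mul_assoc, sgn_mul_self, mul_one]

theorem FMatrix_mem (G : ClassicalGroup) (i j : G.Idx) : G.FMatrix i j ∈ G.lie := by
  have e1 : ∀ a b : G.Idx, (a = -b) = (b = -a) := fun a b =>
    propext ⟨fun h => by rw [h, neg_neg_idx], fun h => by rw [h, neg_neg_idx]⟩
  rw [mem_skewAdjointMatricesLieSubalgebra, mem_skewAdjointMatricesSubmodule]
  change (G.FMatrix i j).transpose * G.form = G.form * (-G.FMatrix i j)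
  ext k l
  have hL : ((G.FMatrix i j).transpose * G.form) k l = G.FMatrix i j (-l) k * G.sgn (-l) := by
    simp [Matrix.mul_apply, form]
  have hR : (G.form * (-G.FMatrix i j)) k l = -(G.sgn k * G.FMatrix i j (-k) l) := by
    simp [Matrix.mul_apply, form, e1 k]
  rw [hL, hR]
  simp only [FMatrix, Matrix.sub_apply, Matrix.smul_apply, Matrix.single_apply, eps, smul_eq_mul]
  have c1 : (i = -l ∧ j = k) = (-j = -k ∧ -i = l) :=
    propext ⟨fun ⟨a, b⟩ => ⟨by rw [b], by rw [a, neg_neg_idx]⟩,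
      fun ⟨a, b⟩ => ⟨by rw [← b, neg_neg_idx], by rw [← G.neg_neg_idx j, a, neg_neg_idx]⟩⟩
  have c2 : (-j = -l ∧ -i = k) = (i = -k ∧ j = l) :=
    propext ⟨fun ⟨a, b⟩ => ⟨by rw [← b, neg_neg_idx], by rw [← G.neg_neg_idx j, a, neg_neg_idx]⟩,
      fun ⟨a, b⟩ => ⟨by rw [b], by rw [a, neg_neg_idx]⟩⟩
  simp only [c1, c2]
  by_cases h1 : -j = -k ∧ -i = l
  · have hjk : j = k := by rw [← G.neg_neg_idx j, h1.1, neg_neg_idx]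
    by_cases h2 : i = -k ∧ j = l
    · rw [if_pos h1, if_pos h2, ← h1.2, ← hjk, neg_neg_idx]
      linear_combination (-G.sgn j) * G.sgn_mul_self i - G.sgn i * G.sgn_mul_self j
    · rw [if_pos h1, if_neg h2, ← h1.2, ← hjk, neg_neg_idx]
      linear_combination (-G.sgn i) * G.sgn_mul_self j
  · by_cases h2 : i = -k ∧ j = l
    · have hk : k = -i := by rw [h2.1, neg_neg_idx]
      rw [if_neg h1, if_pos h2, ← h2.2, hk]
      linear_combination -G.sgn_neg_cancel i j
    · rw [if_neg h1, if_neg h2]; ring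

/-- `F_ij` as a generator of the universal enveloping algebra `U(g)`. -/
noncomputable def FGen (G : ClassicalGroup) (i j : G.Idx) : UniversalEnvelopingAlgebra ℂ G.lie :=
  UniversalEnvelopingAlgebra.ι ℂ (⟨G.FMatrix i j, G.FMatrix_mem i j⟩ : G.lie)

/-- `U(g)(u) = ℂ(u) ⊗ U(g)`, rational functions of the variable `u` with values in `U(g)`. -/
abbrev Coeff (G : ClassicalGroup) : Type :=
  RatFunc ℂ ⊗[ℂ] UniversalEnvelopingAlgebra ℂ G.lie

/-- The number `η`: `1/2` in the orthogonal case and `-1/2` in the symplectic case. -/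
noncomputable def eta : ClassicalGroup → ℂ
  | O _ => 1 / 2
  | Sp _ => -1 / 2

/-- `F(a) = -a - η + ∑_ij E_ij ⊗ F_ji` in `End(ℂ^N) ⊗ U(g)(u)`, for an element `a` of `ℂ(u)`. -/
noncomputable def F (G : ClassicalGroup) (a : RatFunc ℂ) : Matrix G.Idx G.Idx G.Coeff :=
  (-a - RatFunc.C G.eta) • (1 : Matrix G.Idx G.Idx G.Coeff) +
    ∑ i, ∑ j, Matrix.single i j ((1 : RatFunc ℂ) ⊗ₜ[ℂ] G.FGen j i)

/-- `Q = ∑_ij ε_ij E_ij ⊗ E_{-i,-j}` in `End(ℂ^N)^{⊗ 2}`. -/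
noncomputable def Q (G : ClassicalGroup) : Matrix (G.Idx × G.Idx) (G.Idx × G.Idx) ℂ :=
  ∑ i, ∑ j, G.eps i j •
    Matrix.kronecker (Matrix.single i j (1 : ℂ)) (Matrix.single (-i) (-j) (1 : ℂ))

/-- `R̃(a, b) = 1 + Q / (a + b)` in `End(ℂ^N)^{⊗ 2}(u)`, for elements `a, b` of `ℂ(u)` with
`a + b ≠ 0`. -/
noncomputable def RTilde (G : ClassicalGroup) (a b : RatFunc ℂ) :
    Matrix (G.Idx × G.Idx) (G.Idx × G.Idx) (RatFunc ℂ) :=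
  1 + (a + b)⁻¹ • G.Q.map (algebraMap ℂ (RatFunc ℂ))

/-- The map `X ↦ X ⊗ 1` from `End(ℂ^N)^{⊗ n} ⊗ S` to `End(ℂ^N)^{⊗ n} ⊗ U(g)(u)`, where `S` is
`ℂ` or `ℂ(u)`. -/
noncomputable def tensorOne (G : ClassicalGroup) {n : ℕ} {S : Type*} [CommSemiring S]
    [Algebra S G.Coeff] (X : Matrix (Fin n → G.Idx) (Fin n → G.Idx) S) :
    Matrix (Fin n → G.Idx) (Fin n → G.Idx) G.Coeff :=
  X.map (algebraMap S G.Coeff)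

/-- The operator in `(ℂ^N)^{⊗ n}` that corresponds to the diagonal matrix element of `w`. For a
unit vector `w` in the line `W_T` this is `Y_T`. -/
noncomputable def Y (G : ClassicalGroup) {n : ℕ} {W : Type*} [NormedAddCommGroup W]
    [InnerProductSpace ℂ W] (ρ : Representation ℂ (Equiv.Perm (Fin n)) W) (w : W) :
    Matrix (Fin n → G.Idx) (Fin n → G.Idx) ℂ :=
  MonoidAlgebra.lift ℂ _ _ (permuteFactors G.Idx n) (diagonalMatrixElement ρ w)

/-- `u + c_p` in `ℂ(u)`. -/
noncomputable def shift {ν : YoungDiagram} {n : ℕ} (T : StandardTableau ν n) (p : Fin n) :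
    RatFunc ℂ :=
  RatFunc.X + RatFunc.C (T.content p : ℂ)

/-- The element `F_T(u)`, that is `Y_T ⊗ 1` times the product over `p = 1, …, n` (from left to
right) of `(1 + (Q_{1p} + ⋯ + Q_{p-1,p}) ⊗ 1 / (2u + c_p)) F_p(u + c_p)`. -/
noncomputable def FT (G : ClassicalGroup) {ν : YoungDiagram} {n : ℕ} (T : StandardTableau ν n)
    {W : Type*} [NormedAddCommGroup W] [InnerProductSpace ℂ W]
    (ρ : Representation ℂ (Equiv.Perm (Fin n)) W) (w : W) :
    Matrix (Fin n → G.Idx) (Fin n → G.Idx) G.Coeff :=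
  G.tensorOne (G.Y ρ w) *
    ((List.finRange n).map fun p =>
      (1 + (2 * RatFunc.X + RatFunc.C (T.content p : ℂ))⁻¹ •
          ∑ q ∈ Finset.Iio p, G.tensorOne (leg₂ q p G.Q)) *
        leg p (G.F (shift T p))).prod

end ClassicalGroup

/-! The relation Q_qp Q_kp = P_qk Q_kp makes products of R-matrices with a common index p collapse.
Suppose that each Jucys–Murphy element J_k = ∑_{q<k} P_qk with k < p acts on X from the right by the
content c_k. Then the quadratic terms of X ∏_{q<p} R̃_qp(u+c_q, u+c_p) become multiples of single
Q_kp, and the product telescopes to X (1 + ∑ Q_qp / (2u+c_p)); this is `mul_RProd`. So the two sides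
agree factor by factor, provided that Y_T times the first p − 1 factors still has the J_k with k < p
acting from the right by contents.

That invariance is `map_mul_chain_mul_jucysMurphy`, proved by induction on the number of factors for
all joint eigenvectors w of the Jucys–Murphy elements at once. In the summed form the last factor
commutes with permutations of the earlier indices, so every J_k but the last passes through it. For
the last one, let s be the last adjacent transposition and a, b the last two eigenvalues. By the
Yang–Baxter and reflection equations, s + 1/(b − a) intertwines the chain with the chain whose last
two parameters are exchanged (`intertwine_chain`). As in Young's orthogonal form, s w − w/(b − a)
has the eigenvalues a and b exchanged, and it vanishes when b − a = ±1. Comparing the chains for w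
and for this vector forces the last eigenvalue.

Two inputs remain. The vector w_T has the contents as eigenvalues
(`IsYoungVector.jucysMurphy_apply`), because J_k is a difference of two sums of all transpositions,
each acting on an irreducible module by the sum of contents of its shape. The concrete matrices
satisfy the axioms `BrauerRelations` (`brauerRelations_coeff`), and these axioms are all that the
argument uses about 𝔤. -/

/-- The relations between the permutations of tensor factors `P σ`, the contractions `Q p q` and
the copies `E p` of the generating matrix of an orthogonal or symplectic Lie algebra. -/
structure BrauerRelations {K A : Type*} [Field K] [Ring A] [Algebra K A] {n : ℕ}
    (P : Equiv.Perm (Fin n) →* A) (Q : Fin n → Fin n → A) (E : Fin n → A) (η : K) : Prop where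
  perm_mul_Q : ∀ σ p q, P σ * Q p q = Q (σ p) (σ q) * P σ
  perm_mul_E : ∀ σ p, P σ * E p = E (σ p) * P σ
  Q_symm : ∀ p q, p ≠ q → Q p q = Q q p
  Q_mul_Q : ∀ q k p, q ≠ k → q ≠ p → k ≠ p → Q q p * Q k p = P (Equiv.swap q k) * Q k p
  swap_mul_Q : ∀ p q, p ≠ q → P (Equiv.swap p q) * Q p q = (2 * η) • Q p q
  Q_comm_Q : ∀ p q r s, p ≠ r → p ≠ s → q ≠ r → q ≠ s → Commute (Q p q) (Q r s)
  Q_comm_E : ∀ p q r, p ≠ r → q ≠ r → Commute (Q p q) (E r)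
  E_mul_Q : ∀ p q, p ≠ q → E q * Q p q = -(E p * Q p q)
  Q_mul_E : ∀ p q, p ≠ q → Q p q * E q = -(Q p q * E p)
  E_comm : ∀ p q, p ≠ q → E p * E q - E q * E p =
    P (Equiv.swap p q) * (E p - E q) + (E p * Q p q - Q p q * E p)
  eta_sq : (2 * η) * (2 * η) = 1

/-! ### Yang–Baxter and reflection equations from the Brauer relations -/

namespace BrauerRelations

variable {K A : Type*} [Field K] [Ring A] [Algebra K A] {n : ℕ}

/-- The rational `R`-matrix `1 + Q_pq / (a + b)`. -/
def RMat (Q : Fin n → Fin n → A) (a b : K) (p q : Fin n) : A := 1 + (a + b)⁻¹ • Q p q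

/-- `-a - η + E_p`. -/
def FMat (E : Fin n → A) (η a : K) (p : Fin n) : A := (-a - η) • (1 : A) + E p

variable {P : Equiv.Perm (Fin n) →* A} {Q : Fin n → Fin n → A} {E : Fin n → A} {η : K}

theorem swap_sq (P : Equiv.Perm (Fin n) →* A) (p q : Fin n) :
    P (Equiv.swap p q) * P (Equiv.swap p q) = 1 := by
  rw [← map_mul, Equiv.swap_mul_self, map_one]

theorem Q_mul_swap (h : BrauerRelations P Q E η) {p q : Fin n} (hpq : p ≠ q) :
    Q p q * P (Equiv.swap p q) = (2 * η) • Q p q := by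
  have := h.perm_mul_Q (Equiv.swap p q) p q
  rw [Equiv.swap_apply_left, Equiv.swap_apply_right, h.Q_symm q p hpq.symm] at this
  rw [← this, h.swap_mul_Q p q hpq]

/-- The Yang–Baxter equation. -/
theorem yangBaxter (h : BrauerRelations P Q E η) {q p r : Fin n} (hqp : q ≠ p) (hqr : q ≠ r)
    (hpr : p ≠ r) {a b c : K} (hab : b - a ≠ 0) (ha : c + a ≠ 0) (hb : c + b ≠ 0) :
    (P (Equiv.swap p r) + (b - a)⁻¹ • 1) * (RMat Q c a q p * RMat Q c b q r) =
      (RMat Q c b q p * RMat Q c a q r) * (P (Equiv.swap p r) + (b - a)⁻¹ • 1) := by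
  have e1 : P (Equiv.swap p r) * Q q p = Q q r * P (Equiv.swap p r) := by
    rw [h.perm_mul_Q, Equiv.swap_apply_left, Equiv.swap_apply_of_ne_of_ne hqp hqr]
  have e2 : P (Equiv.swap p r) * Q q r = Q q p * P (Equiv.swap p r) := by
    rw [h.perm_mul_Q, Equiv.swap_apply_right, Equiv.swap_apply_of_ne_of_ne hqp hqr]
  -- The only quadratic word in the Q's reduces to a linear one. What remains is 1/(c+a) − 1/(c+b) =
  -- (b−a)/((c+a)(c+b)).
  have e3 : Q q p * Q q r = P (Equiv.swap p r) * Q q r := by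
    rw [h.Q_symm q p hqp, h.Q_symm q r hqr, h.Q_mul_Q p r q hpr hqp.symm hqr.symm]
  have e4 : P (Equiv.swap p r) * (Q q p * Q q r) = Q q r := by
    rw [e3, ← mul_assoc, swap_sq, one_mul]
  have e5 : Q q p * (Q q r * P (Equiv.swap p r)) = Q q p := by
    rw [← mul_assoc, e3, e2, mul_assoc, swap_sq, mul_one]
  simp only [RMat, mul_add, add_mul, smul_mul_assoc, mul_smul_comm, mul_one, one_mul, mul_assoc,
    e1, e2, e4, e5]
  rw [e3, e2]
  match_scalars <;> field_simp <;> ring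

/-- The reflection equation. -/
theorem reflection (h : BrauerRelations P Q E η) {p q : Fin n} (hpq : p ≠ q)
    {a b : K} (hab : b - a ≠ 0) (hs : a + b ≠ 0) :
    (P (Equiv.swap p q) + (b - a)⁻¹ • 1) * (FMat E η a p * (RMat Q a b p q * FMat E η b q)) =
      FMat E η b p * (RMat Q b a p q * FMat E η a q) * (P (Equiv.swap p q) + (b - a)⁻¹ • 1) := by
  set s := P (Equiv.swap p q) with hs'
  have sE1 : s * E p = E q * s := by rw [hs', h.perm_mul_E, Equiv.swap_apply_left]
  have sE2 : E p * s = s * E q := by rw [hs', h.perm_mul_E, Equiv.swap_apply_right]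
  have sQ : s * Q p q = (2 * η) • Q p q := h.swap_mul_Q p q hpq
  have Qs : Q p q * s = (2 * η) • Q p q := h.Q_mul_swap hpq
  have EQ := h.E_mul_Q p q hpq
  have QE := h.Q_mul_E p q hpq
  have ss : s * s = 1 := swap_sq P p q
  -- The commutation relation of the E's, multiplied by s with s² = 1, gives the quadratic words a
  -- normal form.
  have EE : s * (E p * E q) = s * (E q * E p) + (E p - E q) -
      (2 * η) • (E p * Q p q + Q p q * E p) := by
    have h1 : s * (E p * E q - E q * E p) = s * (s * (E p - E q) + (E p * Q p q - Q p q * E p)) := by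
      rw [h.E_comm p q hpq]
    have h2 : s * (E p * Q p q) = -((2 * η) • (E p * Q p q)) := by
      rw [← mul_assoc, sE1, mul_assoc, sQ, mul_smul_comm, EQ, smul_neg]
    have h3 : s * (Q p q * E p) = (2 * η) • (Q p q * E p) := by
      rw [← mul_assoc, sQ, smul_mul_assoc]
    rw [mul_add, ← mul_assoc s s, ss, one_mul, mul_sub s (E p * Q p q), h2, h3, mul_sub] at h1
    rw [sub_eq_iff_eq_add.1 h1, smul_add]
    abel
  have l1 : s * (E p * Q p q) = -((2 * η) • (E p * Q p q)) := by
    rw [← mul_assoc, sE1, mul_assoc, sQ, mul_smul_comm, EQ, smul_neg]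
  have l2 : s * (Q p q * E p) = (2 * η) • (Q p q * E p) := by
    rw [← mul_assoc, sQ, smul_mul_assoc]
  have l3 : s * (E p * (Q p q * E p)) = -((2 * η) • (E p * (Q p q * E p))) := by
    rw [← mul_assoc (E p), ← mul_assoc s, l1, neg_mul, smul_mul_assoc, mul_assoc]
  have r1 : E q * s = s * E p := sE1.symm
  have r2 : Q p q * (s * E q) = -((2 * η) • (Q p q * E p)) := by
    rw [← mul_assoc, Qs, smul_mul_assoc, QE, smul_neg]
  have r3 : E p * (s * E p) = s * (E q * E p) := by
    rw [← mul_assoc, sE2, mul_assoc]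
  simp only [RMat, FMat, mul_add, add_mul, smul_mul_assoc, mul_smul_comm, mul_one, one_mul, mul_assoc,
    l1, l2, l3, EE, r2, r3, Qs, sQ, QE, sE2, r1, smul_add, smul_neg, mul_neg, neg_mul]
  -- Both R-matrices depend only on a + b, so they coincide; the residual scalar identities need
  -- (2η)² = 1.
  rw [add_comm b a]
  have e := h.eta_sq
  match_scalars <;> field_simp <;> ring_nf
  · linear_combination (b - a) * e
  · linear_combination (b - a) * e

theorem perm_mul_RMat (h : BrauerRelations P Q E η) (σ : Equiv.Perm (Fin n)) (a b : K)
    (p q : Fin n) : P σ * RMat Q a b p q = RMat Q a b (σ p) (σ q) * P σ := by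
  simp only [RMat, mul_add, add_mul, mul_one, one_mul, mul_smul_comm, smul_mul_assoc,
    h.perm_mul_Q]

theorem perm_mul_FMat (h : BrauerRelations P Q E η) (σ : Equiv.Perm (Fin n)) (a : K)
    (p : Fin n) : P σ * FMat E η a p = FMat E η a (σ p) * P σ := by
  simp only [FMat, mul_add, add_mul, mul_one, one_mul, mul_smul_comm, smul_mul_assoc,
    h.perm_mul_E]

theorem commute_RMat_RMat (h : BrauerRelations P Q E η) (a b c d : K) {p q r s : Fin n}
    (h1 : p ≠ r) (h2 : p ≠ s) (h3 : q ≠ r) (h4 : q ≠ s) :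
    Commute (RMat Q a b p q) (RMat Q c d r s) :=
  (Commute.one_left _).add_left
    (((Commute.one_right _).add_right ((h.Q_comm_Q p q r s h1 h2 h3 h4).smul_right _)).smul_left _)

theorem commute_RMat_FMat (h : BrauerRelations P Q E η) (a b c : K) {p q r : Fin n}
    (h1 : p ≠ r) (h2 : q ≠ r) : Commute (RMat Q a b p q) (FMat E η c r) :=
  (Commute.one_left _).add_left
    ((((Commute.one_right _).smul_right _).add_right (h.Q_comm_E p q r h1 h2)).smul_left _)

/-! ### Chains of R-matrices and exchange of neighbouring parameters -/

/-- The product of `R_qp(a_q, b)` over the first `k` values of `q`. -/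
def RProd (Q : Fin n → Fin n → A) (a : Fin n → K) (k : ℕ) (b : K) (p : Fin n) : A :=
  (((List.finRange n).take k).map fun q => RMat Q (a q) b q p).prod

/-- The product over the first `k` values of `p` of `(∏_{q < p} R_qp(a_q, a_p)) F_p(a_p)`. -/
def chain (Q : Fin n → Fin n → A) (E : Fin n → A) (η : K) (a : Fin n → K) (k : ℕ) : A :=
  (((List.finRange n).take k).map fun p : Fin n => RProd Q a p (a p) p * FMat E η (a p) p).prod

theorem take_finRange_succ {k : ℕ} (hk : k < n) :
    (List.finRange n).take (k + 1) = (List.finRange n).take k ++ [⟨k, hk⟩] := by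
  rw [List.take_add_one]
  simp [hk]

theorem mem_take_finRange {k : ℕ} {q : Fin n} (hq : q ∈ (List.finRange n).take k) :
    (q : ℕ) < k := by
  obtain ⟨i, hi, rfl⟩ := List.mem_take_iff_getElem.1 hq
  simp only [List.getElem_finRange, Fin.val_cast]
  omega

@[simp] theorem RProd_zero (a : Fin n → K) (b : K) (p : Fin n) : RProd Q a 0 b p = 1 := by
  simp [RProd]

theorem RProd_succ (a : Fin n → K) {k : ℕ} (hk : k < n) (b : K) (p : Fin n) :
    RProd Q a (k + 1) b p = RProd Q a k b p * RMat Q (a ⟨k, hk⟩) b ⟨k, hk⟩ p := by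
  simp [RProd, take_finRange_succ hk]

@[simp] theorem chain_zero (a : Fin n → K) : chain Q E η a 0 = 1 := by
  simp [chain]

theorem chain_succ (a : Fin n → K) {k : ℕ} (hk : k < n) :
    chain Q E η a (k + 1) = chain Q E η a k *
      (RProd Q a k (a ⟨k, hk⟩) ⟨k, hk⟩ * FMat E η (a ⟨k, hk⟩) ⟨k, hk⟩) := by
  simp [chain, take_finRange_succ hk]

theorem RProd_congr {a a' : Fin n → K} {k : ℕ} (haa : ∀ q : Fin n, (q : ℕ) < k → a q = a' q)
    (b : K) (p : Fin n) : RProd Q a k b p = RProd Q a' k b p := by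
  unfold RProd
  congr 1
  refine List.map_congr_left fun q hq => ?_
  rw [haa q (mem_take_finRange hq)]

theorem chain_congr {a a' : Fin n → K} {k : ℕ} (haa : ∀ q : Fin n, (q : ℕ) < k → a q = a' q) :
    chain Q E η a k = chain Q E η a' k := by
  unfold chain
  congr 1
  refine List.map_congr_left fun q hq => ?_
  have hq := mem_take_finRange hq
  rw [haa q hq, RProd_congr fun r hr => haa r (hr.trans hq)]

theorem perm_commute_RProd (h : BrauerRelations P Q E η) {σ : Equiv.Perm (Fin n)} {k : ℕ}
    (hσ : ∀ i : Fin n, (i : ℕ) < k → σ i = i) (a : Fin n → K) (b : K) {p : Fin n} (hp : σ p = p) :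
    Commute (P σ) (RProd Q a k b p) := by
  refine Commute.list_prod_right _ _ fun x hx => ?_
  obtain ⟨q, hq, rfl⟩ := List.mem_map.1 hx
  have := h.perm_mul_RMat σ (a q) b q p
  rwa [hσ q (mem_take_finRange hq), hp] at this

theorem perm_commute_chain (h : BrauerRelations P Q E η) {σ : Equiv.Perm (Fin n)} {k : ℕ}
    (hσ : ∀ i : Fin n, (i : ℕ) < k → σ i = i) (a : Fin n → K) :
    Commute (P σ) (chain Q E η a k) := by
  refine Commute.list_prod_right _ _ fun x hx => ?_
  obtain ⟨q, hq, rfl⟩ := List.mem_map.1 hx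
  have hq := mem_take_finRange hq
  refine (h.perm_commute_RProd (fun i hi => hσ i (hi.trans hq)) _ _ (hσ q hq)).mul_right ?_
  have := h.perm_mul_FMat σ (a q) q
  rwa [hσ q hq] at this

theorem RMat_commute_RProd (h : BrauerRelations P Q E η) (a : Fin n → K) (b c d : K) {k : ℕ}
    {p r s : Fin n} (hr : k ≤ r) (hs : k ≤ s) (hpr : r ≠ p) (hps : s ≠ p) :
    Commute (RMat Q c d r s) (RProd Q a k b p) := by
  refine Commute.list_prod_right _ _ fun x hx => ?_
  obtain ⟨q, hq, rfl⟩ := List.mem_map.1 hx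
  have hq := mem_take_finRange hq
  exact h.commute_RMat_RMat _ _ _ _ (Fin.ne_of_val_ne (by omega)) hpr
    (Fin.ne_of_val_ne (by omega)) hps

theorem FMat_commute_RProd (h : BrauerRelations P Q E η) (a : Fin n → K) (b c : K) {k : ℕ}
    {p r : Fin n} (hr : k ≤ r) (hpr : p ≠ r) :
    Commute (FMat E η c r) (RProd Q a k b p) := by
  refine Commute.list_prod_right _ _ fun x hx => ?_
  obtain ⟨q, hq, rfl⟩ := List.mem_map.1 hx
  have hq := mem_take_finRange hq
  exact (h.commute_RMat_FMat _ _ _ (Fin.ne_of_val_ne (by omega)) hpr).symm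

theorem intertwine_RProd (h : BrauerRelations P Q E η) (a : Fin n → K) {b c : K} {k : ℕ}
    {p r : Fin n} (hp : k ≤ p) (hr : k ≤ r) (hpr : p ≠ r) (hbc : c - b ≠ 0)
    (hb : ∀ q, a q + b ≠ 0) (hc : ∀ q, a q + c ≠ 0) :
    (P (Equiv.swap p r) + (c - b)⁻¹ • 1) * (RProd Q a k b p * RProd Q a k c r) =
      (RProd Q a k c p * RProd Q a k b r) * (P (Equiv.swap p r) + (c - b)⁻¹ • 1) := by
  induction k with
  | zero => simp
  | succ k ih =>
    have hk : k < n := by omega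
    have ih := ih (by omega) (by omega)
    have hkp : (⟨k, hk⟩ : Fin n) ≠ p := Fin.ne_of_val_ne (by simp; omega)
    have hkr : (⟨k, hk⟩ : Fin n) ≠ r := Fin.ne_of_val_ne (by simp; omega)
    -- The new factor with legs k, p shares no leg with the earlier factors with legs q, r, so the
    -- two new factors can be collected at the right end, where Yang–Baxter applies.
    have key : ∀ b c : K, RProd Q a (k + 1) b p * RProd Q a (k + 1) c r =
        (RProd Q a k b p * RProd Q a k c r) *
          (RMat Q (a ⟨k, hk⟩) b ⟨k, hk⟩ p * RMat Q (a ⟨k, hk⟩) c ⟨k, hk⟩ r) := by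
      intro b c
      have := h.RMat_commute_RProd a c (a ⟨k, hk⟩) b (k := k) (p := r) (r := ⟨k, hk⟩) (s := p)
        le_rfl (by omega) hkr hpr
      rw [RProd_succ a hk, RProd_succ a hk]
      simp only [mul_assoc]
      rw [← mul_assoc (RMat Q (a ⟨k, hk⟩) b ⟨k, hk⟩ p), this.eq, mul_assoc]
    rw [key, key, ← mul_assoc, ih, mul_assoc, h.yangBaxter hkp hkr hpr hbc (hb _) (hc _)]
    simp only [mul_assoc]

theorem swap_apply_of_lt {k l m : Fin n} {j : ℕ} (hl : j ≤ l) (hm : j ≤ m) (hk : (k : ℕ) < j) :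
    Equiv.swap l m k = k :=
  Equiv.swap_apply_of_ne_of_ne (Fin.ne_of_val_ne (by omega)) (Fin.ne_of_val_ne (by omega))

/-- Exchanging two neighbouring parameters in the chain. -/
theorem intertwine_chain (h : BrauerRelations P Q E η) (a : Fin n → K) {l : ℕ}
    (hl : l < n) (hm : l + 1 < n) (hab : a ⟨l + 1, hm⟩ - a ⟨l, hl⟩ ≠ 0)
    (ha : ∀ p q, a p + a q ≠ 0) :
    (P (Equiv.swap ⟨l, hl⟩ ⟨l + 1, hm⟩) + (a ⟨l + 1, hm⟩ - a ⟨l, hl⟩)⁻¹ • 1) *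
        chain Q E η a (l + 2) =
      chain Q E η (a ∘ Equiv.swap ⟨l, hl⟩ ⟨l + 1, hm⟩) (l + 2) *
        (P (Equiv.swap ⟨l, hl⟩ ⟨l + 1, hm⟩) + (a ⟨l + 1, hm⟩ - a ⟨l, hl⟩)⁻¹ • 1) := by
  set i : Fin n := ⟨l, hl⟩
  set j : Fin n := ⟨l + 1, hm⟩
  have hij : i ≠ j := Fin.ne_of_val_ne (by simp [i, j])
  -- F_i moves past the factors R_qj with q < l. This isolates a block for repeated Yang–Baxter and
  -- the word F_i R_ij F_j for the reflection equation.
  have key : ∀ a : Fin n → K, chain Q E η a (l + 2) = chain Q E η a l *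
      ((RProd Q a l (a i) i * RProd Q a l (a j) j) *
        (FMat E η (a i) i * (RMat Q (a i) (a j) i j * FMat E η (a j) j))) := by
    intro a
    have := h.FMat_commute_RProd a (a j) (a i) (k := l) (p := j) (r := i) le_rfl hij.symm
    rw [chain_succ a hm, chain_succ a hl, RProd_succ a hl]
    simp only [mul_assoc]
    rw [← mul_assoc (FMat E η (a i) i), this.eq, mul_assoc]
  have hfix : ∀ q : Fin n, (q : ℕ) < l → (a ∘ Equiv.swap i j) q = a q := fun q hq =>
    congrArg a (swap_apply_of_lt le_rfl (Nat.le_succ l) hq)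
  have c1 : (P (Equiv.swap i j) + (a j - a i)⁻¹ • 1) * chain Q E η a l =
      chain Q E η a l * (P (Equiv.swap i j) + (a j - a i)⁻¹ • 1) :=
    ((h.perm_commute_chain (fun q hq => swap_apply_of_lt le_rfl (Nat.le_succ l) hq) a).add_left
      ((Commute.one_left _).smul_left _)).eq
  rw [key a, key (a ∘ Equiv.swap i j), chain_congr hfix, RProd_congr hfix, RProd_congr hfix]
  simp only [Function.comp_apply, Equiv.swap_apply_left, Equiv.swap_apply_right]
  rw [← mul_assoc, c1, mul_assoc, ← mul_assoc (P _ + _),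
    h.intertwine_RProd a (le_refl l) (Nat.le_succ l) hij hab (fun q => ha q i) (fun q => ha q j),
    mul_assoc, h.reflection hij hab (ha i j)]
  simp only [mul_assoc]

/-! ### Jucys–Murphy elements and the telescoping of R-matrices -/

section JucysMurphy

variable {B : Type*} [Ring B]

/-- The Jucys–Murphy element `∑_{q < k} P_{qk}`. -/
def jucysMurphy (P : Equiv.Perm (Fin n) →* B) (k : Fin n) : B :=
  ∑ q ∈ Finset.Iio k, P (Equiv.swap q k)

theorem sum_Iio_perm {M : Type*} [AddCommMonoid M] {σ : Equiv.Perm (Fin n)} {k : Fin n}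
    (hσ : ∀ i, i < k ↔ σ i < k) (f : Fin n → M) :
    ∑ q ∈ Finset.Iio k, f (σ q) = ∑ q ∈ Finset.Iio k, f q :=
  Finset.sum_equiv σ (by simpa using hσ) fun _ _ => rfl

theorem perm_mul_jucysMurphy (P : Equiv.Perm (Fin n) →* B) {σ : Equiv.Perm (Fin n)} {k : Fin n}
    (hσ : ∀ i, i < k ↔ σ i < k) (hk : σ k = k) : Commute (P σ) (jucysMurphy P k) := by
  unfold Commute SemiconjBy jucysMurphy
  rw [Finset.mul_sum, Finset.sum_mul, ← sum_Iio_perm hσ fun q => P (Equiv.swap q k) * P σ]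
  refine Finset.sum_congr rfl fun q _ => ?_
  rw [← map_mul, ← map_mul, Equiv.mul_swap_eq_swap_mul, hk]

theorem swap_lt_iff {i k l m : Fin n} (h : l < k ∧ m < k ∨ k ≤ l ∧ k ≤ m) :
    i < k ↔ Equiv.swap l m i < k := by
  rw [Equiv.swap_apply_def]
  split_ifs <;> simp_all <;> omega

theorem sum_Iio_succ {M : Type*} [AddCommMonoid M] {l : ℕ} (hl : l < n) (hm : l + 1 < n)
    (f : Fin n → M) : ∑ q ∈ Finset.Iio (⟨l + 1, hm⟩ : Fin n), f q =
      ∑ q ∈ Finset.Iio (⟨l, hl⟩ : Fin n), f q + f ⟨l, hl⟩ := by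
  have : Finset.Iio (⟨l + 1, hm⟩ : Fin n) = insert ⟨l, hl⟩ (Finset.Iio ⟨l, hl⟩) := by
    ext q
    simp only [Finset.mem_Iio, Finset.mem_insert, Fin.lt_def, Fin.ext_iff]
    omega
  rw [this, Finset.sum_insert (by simp), add_comm]

/-- Conjugation by the adjacent transposition turns each (q l) into (q l+1); the extra term is (l
l+1) itself. -/
theorem jucysMurphy_succ (P : Equiv.Perm (Fin n) →* B) {l : ℕ} (hl : l < n) (hm : l + 1 < n) :
    jucysMurphy P ⟨l + 1, hm⟩ = P (Equiv.swap ⟨l, hl⟩ ⟨l + 1, hm⟩) * jucysMurphy P ⟨l, hl⟩ *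
      P (Equiv.swap ⟨l, hl⟩ ⟨l + 1, hm⟩) + P (Equiv.swap ⟨l, hl⟩ ⟨l + 1, hm⟩) := by
  unfold jucysMurphy
  rw [sum_Iio_succ hl hm, Finset.mul_sum, Finset.sum_mul]
  congr 1
  refine Finset.sum_congr rfl fun q hq => ?_
  have hq : q < ⟨l, hl⟩ := by simpa using hq
  rw [Fin.lt_def] at hq
  rw [← map_mul, Equiv.mul_swap_eq_swap_mul, Equiv.swap_apply_left,
    swap_apply_of_lt le_rfl (Nat.le_succ l) hq, ← map_mul, mul_assoc, Equiv.swap_mul_self, mul_one]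

theorem jucysMurphy_mul_swap (P : Equiv.Perm (Fin n) →* B) {l : ℕ} (hl : l < n)
    (hm : l + 1 < n) :
    jucysMurphy P ⟨l, hl⟩ * P (Equiv.swap ⟨l, hl⟩ ⟨l + 1, hm⟩) =
      P (Equiv.swap ⟨l, hl⟩ ⟨l + 1, hm⟩) * jucysMurphy P ⟨l + 1, hm⟩ - 1 := by
  have e : P (Equiv.swap ⟨l, hl⟩ ⟨l + 1, hm⟩) * P (Equiv.swap ⟨l, hl⟩ ⟨l + 1, hm⟩) = 1 := by
    rw [← map_mul, Equiv.swap_mul_self, map_one]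
  rw [jucysMurphy_succ P hl hm, mul_add, e, ← mul_assoc, ← mul_assoc, e, one_mul, add_sub_cancel_right]

end JucysMurphy

/-- If the Jucys–Murphy elements act on `X` from the right by scalars, then the product of
`R`-matrices can be replaced by one sum. -/
theorem mul_RProd (h : BrauerRelations P Q E η) (X : A) (u : K) (c : Fin n → K) {k : ℕ}
    (hX : ∀ q : Fin n, (q : ℕ) < k → X * jucysMurphy P q = c q • X) {b : K} {p : Fin n}
    (hk : k ≤ p) (hub : u + b ≠ 0) (hc : ∀ q, u + c q + b ≠ 0) :
    X * RProd Q (fun q => u + c q) k b p =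
      X * (1 + (u + b)⁻¹ • ∑ q ∈ Finset.Iio (⟨k, hk.trans_lt p.2⟩ : Fin n), Q q p) := by
  induction k with
  | zero =>
    have : Finset.Iio (⟨0, hk.trans_lt p.2⟩ : Fin n) = ∅ := by
      ext q; simp [Fin.lt_def]
    rw [this]; simp
  | succ k ih =>
    have hkn : k < n := by omega
    obtain ⟨i, hi⟩ : ∃ i : Fin n, i = ⟨k, hkn⟩ := ⟨_, rfl⟩
    have hik : (i : ℕ) = k := by rw [hi]
    have hip : i ≠ p := Fin.ne_of_val_ne (by omega)
    -- Termwise Q_qp Q_ip = P_qi Q_ip, so a Jucys–Murphy element appears, and it can be absorbed by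
    -- X as the scalar c_i.
    have e1 : (∑ q ∈ Finset.Iio i, Q q p) * Q i p = jucysMurphy P i * Q i p := by
      rw [jucysMurphy, Finset.sum_mul, Finset.sum_mul]
      refine Finset.sum_congr rfl fun q hq => ?_
      have hq : q < i := by simpa using hq
      have hqp : q < p := hq.trans (Fin.lt_def.2 (by omega))
      exact h.Q_mul_Q q i p hq.ne hqp.ne hip
    have e2 : X * ((∑ q ∈ Finset.Iio i, Q q p) * Q i p) = c i • (X * Q i p) := by
      rw [e1, ← mul_assoc, hX i (by omega), smul_mul_assoc]
    rw [RProd_succ _ hkn, ← mul_assoc, ih (fun q hq => hX q (by omega)) (by omega),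
      sum_Iio_succ hkn (hk.trans_lt p.2), ← hi]
    have h1 := hc i
    simp only [RMat, mul_add, add_mul, mul_one, mul_smul_comm, smul_mul_assoc,
      mul_assoc, e2]
    -- The coefficient of Q_ip is (1 + c_i/(u+b)) / (u+c_i+b) = 1/(u+b), independent of i.
    match_scalars
    all_goals field_simp
    all_goals ring

end BrauerRelations

/-! ### Young's orthogonal form for an adjacent transposition -/

section Unitary

variable {n : ℕ} {W : Type*} [NormedAddCommGroup W] [InnerProductSpace ℂ W]
  {ρ : Representation ℂ (Equiv.Perm (Fin n)) W}

open BrauerRelations (jucysMurphy jucysMurphy_succ jucysMurphy_mul_swap)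

/-- A transposition acts by a unitary involution, hence by a self-adjoint operator. -/
theorem inner_jucysMurphy
    (hinv : ∀ (σ : Equiv.Perm (Fin n)) (x y : W), inner ℂ (ρ σ x) (ρ σ y) = inner ℂ x y)
    (k : Fin n) (x y : W) :
    inner ℂ (jucysMurphy ρ k x) y = inner ℂ x (jucysMurphy ρ k y) := by
  simp only [jucysMurphy, LinearMap.sum_apply, sum_inner, inner_sum]
  refine Finset.sum_congr rfl fun q _ => ?_
  rw [← hinv (Equiv.swap q k), ← Module.End.mul_apply, ← map_mul, Equiv.swap_mul_self, map_one,
    Module.End.one_apply]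

theorem inner_eq_zero_of_jucysMurphy
    (hinv : ∀ (σ : Equiv.Perm (Fin n)) (x y : W), inner ℂ (ρ σ x) (ρ σ y) = inner ℂ x y)
    {k : Fin n} {x y : W} {a b : ℝ} (hx : jucysMurphy ρ k x = (b : ℂ) • x)
    (hy : jucysMurphy ρ k y = (a : ℂ) • y) (hab : a ≠ b) : inner ℂ x y = 0 := by
  have h := inner_jucysMurphy hinv k x y
  rw [hx, hy, inner_smul_left, inner_smul_right, Complex.conj_ofReal] at h
  have h' : ((b : ℂ) - a) * inner ℂ x y = 0 := by linear_combination h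
  refine (mul_eq_zero.1 h').resolve_left (sub_ne_zero.2 ?_)
  exact_mod_cast hab.symm

variable {l : ℕ} {hl : l < n} {hm : l + 1 < n} {a b : ℝ} {w : W}

theorem swap_swap_apply (ρ : Representation ℂ (Equiv.Perm (Fin n)) W) (i j : Fin n) (w : W) :
    ρ (Equiv.swap i j) (ρ (Equiv.swap i j) w) = w := by
  rw [← Module.End.mul_apply, ← map_mul, Equiv.swap_mul_self, map_one, Module.End.one_apply]

theorem jucysMurphy_swap_apply (hb : jucysMurphy ρ ⟨l + 1, hm⟩ w = (b : ℂ) • w) :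
    jucysMurphy ρ ⟨l, hl⟩ (ρ (Equiv.swap ⟨l, hl⟩ ⟨l + 1, hm⟩) w) =
      (b : ℂ) • ρ (Equiv.swap ⟨l, hl⟩ ⟨l + 1, hm⟩) w - w := by
  rw [← Module.End.mul_apply, jucysMurphy_mul_swap, LinearMap.sub_apply, Module.End.mul_apply, hb,
    map_smul, Module.End.one_apply]

/-- If a = b, then J_l (s w) = a s w − w; pairing with w and using that J_l is self-adjoint leaves
‖w‖² = 0. -/
theorem ne_of_jucysMurphy
    (hinv : ∀ (σ : Equiv.Perm (Fin n)) (x y : W), inner ℂ (ρ σ x) (ρ σ y) = inner ℂ x y)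
    (ha : jucysMurphy ρ ⟨l, hl⟩ w = (a : ℂ) • w)
    (hb : jucysMurphy ρ ⟨l + 1, hm⟩ w = (b : ℂ) • w) (hw : w ≠ 0) : a ≠ b := by
  rintro rfl
  have h := inner_jucysMurphy hinv ⟨l, hl⟩ (ρ (Equiv.swap ⟨l, hl⟩ ⟨l + 1, hm⟩) w) w
  rw [jucysMurphy_swap_apply hb, ha, inner_sub_left, inner_smul_left, inner_smul_right,
    Complex.conj_ofReal] at h
  exact hw ((inner_self_eq_zero (𝕜 := ℂ)).1 (by linear_combination -h))

/-- On the span of w and s w the operator J_l is triangular with diagonal entries a and b. The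
multiple of w subtracted from s w is the one that diagonalizes it. -/
theorem jucysMurphy_swap_sub (ha : jucysMurphy ρ ⟨l, hl⟩ w = (a : ℂ) • w)
    (hb : jucysMurphy ρ ⟨l + 1, hm⟩ w = (b : ℂ) • w) (hab : a ≠ b) :
    jucysMurphy ρ ⟨l, hl⟩ (ρ (Equiv.swap ⟨l, hl⟩ ⟨l + 1, hm⟩) w - (((b - a)⁻¹ : ℝ) : ℂ) • w) =
      (b : ℂ) • (ρ (Equiv.swap ⟨l, hl⟩ ⟨l + 1, hm⟩) w - (((b - a)⁻¹ : ℝ) : ℂ) • w) := by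
  rw [map_sub, map_smul, jucysMurphy_swap_apply hb, ha]
  have : (b : ℂ) - a ≠ 0 := sub_ne_zero.2 (by exact_mod_cast hab.symm)
  push_cast
  match_scalars <;> field_simp
  ring

theorem jucysMurphy_succ_swap_sub (ha : jucysMurphy ρ ⟨l, hl⟩ w = (a : ℂ) • w)
    (hb : jucysMurphy ρ ⟨l + 1, hm⟩ w = (b : ℂ) • w) (hab : a ≠ b) :
    jucysMurphy ρ ⟨l + 1, hm⟩
        (ρ (Equiv.swap ⟨l, hl⟩ ⟨l + 1, hm⟩) w - (((b - a)⁻¹ : ℝ) : ℂ) • w) =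
      (a : ℂ) • (ρ (Equiv.swap ⟨l, hl⟩ ⟨l + 1, hm⟩) w - (((b - a)⁻¹ : ℝ) : ℂ) • w) := by
  have e : jucysMurphy ρ ⟨l + 1, hm⟩ (ρ (Equiv.swap ⟨l, hl⟩ ⟨l + 1, hm⟩) w) =
      (a : ℂ) • ρ (Equiv.swap ⟨l, hl⟩ ⟨l + 1, hm⟩) w + w := by
    rw [jucysMurphy_succ _ hl hm, LinearMap.add_apply, Module.End.mul_apply, Module.End.mul_apply,
      swap_swap_apply, ha, map_smul]
  rw [map_sub, map_smul, hb, e]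
  have : (b : ℂ) - a ≠ 0 := sub_ne_zero.2 (by exact_mod_cast hab.symm)
  push_cast
  match_scalars <;> field_simp
  ring

/-- With x = 1/(b − a), the vector w' = s w − x w has J_l-eigenvalue b, hence is orthogonal to w. If
x² = 1, then s w' = −x w', so by invariance w' is orthogonal to s w as well, and therefore to
itself. -/
theorem swap_eq_of_sq_eq_one
    (hinv : ∀ (σ : Equiv.Perm (Fin n)) (x y : W), inner ℂ (ρ σ x) (ρ σ y) = inner ℂ x y)
    (ha : jucysMurphy ρ ⟨l, hl⟩ w = (a : ℂ) • w)
    (hb : jucysMurphy ρ ⟨l + 1, hm⟩ w = (b : ℂ) • w) (hab : a ≠ b)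
    (hsq : (b - a)⁻¹ * (b - a)⁻¹ = 1) :
    ρ (Equiv.swap ⟨l, hl⟩ ⟨l + 1, hm⟩) w = (((b - a)⁻¹ : ℝ) : ℂ) • w := by
  rw [← sub_eq_zero]
  have h0 := inner_eq_zero_of_jucysMurphy hinv (jucysMurphy_swap_sub ha hb hab) ha hab
  generalize (b - a)⁻¹ = x at *
  set s := Equiv.swap (⟨l, hl⟩ : Fin n) ⟨l + 1, hm⟩ with hs
  have hsq' : (x : ℂ) * x = 1 := by exact_mod_cast hsq
  have e : ρ s (ρ s w - (x : ℂ) • w) = -(x : ℂ) • (ρ s w - (x : ℂ) • w) := by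
    rw [map_sub, map_smul, hs, swap_swap_apply]
    match_scalars
    · linear_combination -hsq'
    · ring
  have e2 : inner ℂ (ρ s w - (x : ℂ) • w) (ρ s w) = 0 := by
    rw [← hinv s, e, hs, swap_swap_apply, inner_smul_left, h0, mul_zero]
  rw [← inner_self_eq_zero (𝕜 := ℂ)]
  conv_lhs => rw [inner_sub_right, inner_smul_right, h0, e2]
  simp

end Unitary

/-! ### Right action of the Jucys–Murphy elements on the chain -/

namespace BrauerRelations

variable {K A : Type*} [Field K] [Ring A] [Algebra K A] {n : ℕ}
  {P : Equiv.Perm (Fin n) →* A} {Q : Fin n → Fin n → A} {E : Fin n → A} {η : K}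
  {W : Type*} [NormedAddCommGroup W] [InnerProductSpace ℂ W]
  {ρ : Representation ℂ (Equiv.Perm (Fin n)) W}

theorem jucysMurphy_zero {B : Type*} [Ring B] (P : Equiv.Perm (Fin n) →* B) (hm : 0 < n) :
    jucysMurphy P ⟨0, hm⟩ = 0 :=
  Finset.sum_eq_zero fun q hq => by simp [Fin.lt_def] at hq

theorem commute_sum_Q (h : BrauerRelations P Q E η) {σ : Equiv.Perm (Fin n)} {p : Fin n}
    (hσ : ∀ i, i < p ↔ σ i < p) (hp : σ p = p) :
    Commute (P σ) (∑ q ∈ Finset.Iio p, Q q p) := by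
  unfold Commute SemiconjBy
  rw [Finset.mul_sum, Finset.sum_mul, ← sum_Iio_perm hσ fun q => Q q p * P σ]
  refine Finset.sum_congr rfl fun q _ => ?_
  rw [h.perm_mul_Q, hp]

/-- The factor `(1 + ∑_{q < p} Q_qp / (2u + c_p)) F_p(u + c_p)`. -/
def sumFactor (Q : Fin n → Fin n → A) (E : Fin n → A) (η : K) (u : K) (c : Fin n → K)
    (p : Fin n) : A :=
  (1 + (u + (u + c p))⁻¹ • ∑ q ∈ Finset.Iio p, Q q p) * FMat E η (u + c p) p

/-- A permutation of the indices below p only reorders the sum of the Q_qp. The ordered product of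
R-matrices with different parameters has no such visible symmetry, which is why the summed form is
used in the induction. -/
theorem commute_sumFactor (h : BrauerRelations P Q E η) (u : K) (c : Fin n → K)
    {σ : Equiv.Perm (Fin n)} {p : Fin n} (hσ : ∀ i, i < p ↔ σ i < p) (hp : σ p = p) :
    Commute (P σ) (sumFactor Q E η u c p) := by
  refine ((Commute.one_right _).add_right ((h.commute_sum_Q hσ hp).smul_right _)).mul_right ?_
  have := h.perm_mul_FMat σ (u + c p) p
  rwa [hp] at this

theorem jucysMurphy_commute_sumFactor (h : BrauerRelations P Q E η) (u : K) (c : Fin n → K)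
    {i p : Fin n} (hip : i < p) : Commute (jucysMurphy P i) (sumFactor Q E η u c p) := by
  refine Commute.sum_left _ _ _ fun q hq => ?_
  have hq : q < i := by simpa using hq
  refine h.commute_sumFactor u c (fun j => swap_lt_iff (Or.inl ⟨hq.trans hip, hip⟩)) ?_
  exact Equiv.swap_apply_of_ne_of_ne (hq.trans hip).ne' hip.ne'

section Eigen

variable {f : ℝ →+* K} {u : K}

/-- Both denominators, u + (u + c_k) and (u + c_q) + (u + c_k), have the form 2u + r with r real, so
one nonvanishing assumption covers them. -/
theorem mul_chain_succ (h : BrauerRelations P Q E η) (hu : ∀ r : ℝ, u + u + f r ≠ 0)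
    (X : A) (c : Fin n → ℝ) {k : ℕ} (hk : k < n)
    (hX : ∀ i : Fin n, (i : ℕ) < k → X * chain Q E η (fun p => u + f (c p)) k * jucysMurphy P i =
      f (c i) • (X * chain Q E η (fun p => u + f (c p)) k)) :
    X * chain Q E η (fun p => u + f (c p)) (k + 1) =
      X * chain Q E η (fun p => u + f (c p)) k * sumFactor Q E η u (fun p => f (c p)) ⟨k, hk⟩ := by
  rw [chain_succ _ hk, ← mul_assoc, ← mul_assoc, h.mul_RProd _ u (fun p => f (c p)) hX le_rfl, mul_assoc,
    sumFactor]
  · rw [← add_assoc]; exact hu _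
  · intro q
    have := hu (c q + c ⟨k, hk⟩)
    rw [map_add] at this
    intro h0
    exact this (by rw [← h0]; ring)

/-- The Jucys–Murphy elements act from the right on the chain with the eigenvalues by which they
act from the left. -/
theorem map_mul_chain_mul_jucysMurphy (h : BrauerRelations P Q E η)
    (hu : ∀ r : ℝ, u + u + f r ≠ 0)
    (hinv : ∀ (σ : Equiv.Perm (Fin n)) (x y : W), inner ℂ (ρ σ x) (ρ σ y) = inner ℂ x y)
    {Φ : W →+ A} (hΦ : ∀ σ w, Φ (ρ σ w) * P σ = Φ w)
    (hΦs : ∀ (r : ℝ) w, Φ ((r : ℂ) • w) = f r • Φ w)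
    {k : ℕ} (hk : k ≤ n) (c : Fin n → ℝ) (w : W)
    (hw : ∀ i : Fin n, (i : ℕ) < k → jucysMurphy ρ i w = (c i : ℂ) • w)
    (i : Fin n) (hi : (i : ℕ) < k) :
    Φ w * chain Q E η (fun p => u + f (c p)) k * jucysMurphy P i =
      f (c i) • (Φ w * chain Q E η (fun p => u + f (c p)) k) := by
  induction k generalizing c w i with
  | zero => omega
  | succ m ih =>
    have hm : m < n := hk
    have ih := ih hm.le
    -- All eigenvalues but the last survive one more factor. The claim is kept general in c and w
    -- because it is also applied to the vector with two eigenvalues exchanged.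
    have lower : ∀ (c : Fin n → ℝ) (w : W),
        (∀ i : Fin n, (i : ℕ) < m + 1 → jucysMurphy ρ i w = (c i : ℂ) • w) →
        ∀ i : Fin n, (i : ℕ) < m →
        Φ w * chain Q E η (fun p => u + f (c p)) (m + 1) * jucysMurphy P i =
          f (c i) • (Φ w * chain Q E η (fun p => u + f (c p)) (m + 1)) := by
      intro c w hw i hi
      have hw' := ih c w fun i hi => hw i (by omega)
      rw [h.mul_chain_succ hu _ c hm hw', mul_assoc,
        ← (h.jucysMurphy_commute_sumFactor u _ (i := i) (p := ⟨m, hm⟩) hi).eq, ← mul_assoc, hw' i hi,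
        smul_mul_assoc]
    rcases Nat.lt_succ_iff_lt_or_eq.1 hi with hlt | rfl
    · exact lower c w hw i hlt
    rcases eq_or_ne w 0 with rfl | hw0
    · simp
    obtain ⟨m, hm⟩ := i
    cases m with
    | zero =>
      -- The first Jucys–Murphy element is an empty sum, so its eigenvalue on w contributes nothing
      -- either.
      have h0 : (c ⟨0, hm⟩ : ℂ) • w = 0 := by
        rw [← hw _ hi, jucysMurphy_zero, LinearMap.zero_apply]
      rw [jucysMurphy_zero, mul_zero, ← smul_mul_assoc, ← hΦs, h0, map_zero, zero_mul]
    | succ l =>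
      have hl : l < n := by omega
      set s : Equiv.Perm (Fin n) := Equiv.swap ⟨l, hl⟩ ⟨l + 1, hm⟩ with hs
      set a := c ⟨l, hl⟩ with ha
      set b := c ⟨l + 1, hm⟩ with hb
      have haw : jucysMurphy ρ ⟨l, hl⟩ w = (a : ℂ) • w := hw ⟨l, hl⟩ (by simp)
      have hbw : jucysMurphy ρ ⟨l + 1, hm⟩ w = (b : ℂ) • w := hw _ hi
      have hab : a ≠ b := ne_of_jucysMurphy hinv haw hbw hw0
      have hba : b - a ≠ 0 := sub_ne_zero.2 hab.symm
      have hx0 : (b - a)⁻¹ ≠ 0 := inv_ne_zero hba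
      have hfba : f b - f a ≠ 0 := by rw [← map_sub]; exact (map_ne_zero f).2 hba
      have hw' : jucysMurphy ρ ⟨l, hl⟩ (ρ s w - (((b - a)⁻¹ : ℝ) : ℂ) • w) =
        (b : ℂ) • (ρ s w - (((b - a)⁻¹ : ℝ) : ℂ) • w) := jucysMurphy_swap_sub haw hbw hab
      have hw'' : jucysMurphy ρ ⟨l + 1, hm⟩ (ρ s w - (((b - a)⁻¹ : ℝ) : ℂ) • w) =
        (a : ℂ) • (ρ s w - (((b - a)⁻¹ : ℝ) : ℂ) • w) := jucysMurphy_succ_swap_sub haw hbw hab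
      have hspec := swap_eq_of_sq_eq_one (hl := hl) (hm := hm) hinv haw hbw hab
      have hxba : f (b - a)⁻¹ * (f b - f a) = 1 := by
        rw [map_inv₀, map_sub, inv_mul_cancel₀ hfba]
      have inter : (P s + f (b - a)⁻¹ • 1) * chain Q E η (fun p => u + f (c p)) (l + 2) =
          chain Q E η (fun p => u + f ((c ∘ s) p)) (l + 2) * (P s + f (b - a)⁻¹ • 1) := by
        have := h.intertwine_chain (fun p => u + f (c p)) hl hm (by simpa using hfba) (by
          intro p q
          have := hu (c p + c q)
          rw [map_add] at this
          intro h0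
          exact this (by rw [← h0]; ring))
        rw [map_inv₀, map_sub]
        simp only [add_sub_add_left_eq_sub] at this
        exact this
      have hss : P s * P s = 1 := swap_sq P _ _
      have J1 : jucysMurphy P ⟨l + 1, hm⟩ * P s = P s * jucysMurphy P ⟨l, hl⟩ + 1 := by
        rw [jucysMurphy_succ P hl hm, add_mul, mul_assoc _ (P _) (P _), hss, mul_one]
      have J2 : P s * jucysMurphy P ⟨l + 1, hm⟩ = jucysMurphy P ⟨l, hl⟩ * P s + 1 := by
        rw [jucysMurphy_mul_swap P hl hm, sub_add_cancel]
      have hΦP : ∀ w, Φ w * P s = Φ (ρ s w) := by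
        intro w
        rw [← hΦ s (ρ s w), swap_swap_apply]
      have lowV := lower c w hw ⟨l, hl⟩ (Nat.lt_succ_self l)
      change _ = f b • _
      change _ = f a • _ at lowV
      generalize hx : (b - a)⁻¹ = x at *
      set V := Φ w * chain Q E η (fun p => u + f (c p)) (l + 1 + 1) with hV
      -- If x² = 1, then w is an eigenvector of s and the intertwiner gives V s = x V. Otherwise s +
      -- x can be inverted, and w is recovered from its partner s w − x w.
      by_cases hsq : x * x = 1
      · have hfx : f x * f x = 1 := by rw [← map_mul, hsq, map_one]
        have h2 : (2 * f x) ≠ 0 := by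
          have : f (2 * x) ≠ 0 := (map_ne_zero f).2 (mul_ne_zero two_ne_zero hx0)
          rwa [map_mul, map_ofNat] at this
        have hw1 : Φ w * (P s + f x • 1) = (2 * f x) • Φ w := by
          rw [mul_add, hΦP, hspec hsq, hΦs, mul_smul_comm, mul_one, ← add_smul, two_mul]
        have hV1 : (2 * f x) • V =
            Φ w * chain Q E η (fun p => u + f ((c ∘ s) p)) (l + 2) * (P s + f x • 1) := by
          rw [hV, ← smul_mul_assoc, ← hw1, mul_assoc, inter, mul_assoc]
        have hVs : V * P s = f x • V := by
          have : (2 * f x) • (V * P s) = (2 * f x) • (f x • V) := by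
            rw [← smul_mul_assoc, smul_comm _ (f x), hV1, mul_assoc, add_mul, hss, ← mul_smul_comm,
              smul_add, smul_smul, hfx, one_smul, smul_mul_assoc, one_mul, add_comm (1 : A)]
          exact smul_right_injective A h2 this
        -- From x (b − a) = 1 and x² = 1 it follows that b − a = x.
        have hxb : f b = f a + f x := by linear_combination f x * hxba - (f b - f a) * hfx
        rw [jucysMurphy_succ P hl hm, mul_add, ← mul_assoc, ← mul_assoc, hVs, smul_mul_assoc, lowV,
          smul_mul_assoc, smul_mul_assoc, hVs, hxb]
        match_scalars
        linear_combination f a * hfx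
      · have hfx : 1 - f x * f x ≠ 0 := by
          have : f (1 - x * x) ≠ 0 := (map_ne_zero f).2 (sub_ne_zero.2 (Ne.symm hsq))
          simpa using this
        have hΦw' : Φ (ρ s w - (x : ℂ) • w) = Φ w * P s - f x • Φ w := by
          rw [map_sub, hΦs, hΦP]
        have low' := lower (c ∘ s) (ρ s w - (x : ℂ) • w) (by
          intro i hi
          rcases Nat.lt_succ_iff_lt_or_eq.1 hi with hi | hi
          · rcases Nat.lt_succ_iff_lt_or_eq.1 hi with hi | hi
            · have hsi : s i = i := swap_apply_of_lt le_rfl (Nat.le_succ l) hi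
              have hc : Commute (ρ s) (jucysMurphy ρ i) := perm_mul_jucysMurphy ρ
                (fun j => swap_lt_iff (Or.inr ⟨hi.le, hi.le.trans (Nat.le_succ l)⟩)) hsi
              rw [Function.comp_apply, hsi, map_sub, map_smul, ← Module.End.mul_apply, ← hc.eq,
                Module.End.mul_apply, hw i (by omega), map_smul, smul_sub, smul_comm (x : ℂ)]
            · obtain rfl : i = ⟨l, hl⟩ := Fin.ext hi
              rw [hw', Function.comp_apply, hs, Equiv.swap_apply_left]
          · obtain rfl : i = ⟨l + 1, hm⟩ := Fin.ext hi
            rw [hw'', Function.comp_apply, hs, Equiv.swap_apply_right]) ⟨l, hl⟩ (Nat.lt_succ_self l)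
        rw [Function.comp_apply, hs, Equiv.swap_apply_left, ← hs, ← hb] at low'
        set V' := Φ (ρ s w - (x : ℂ) • w) *
          chain Q E η (fun p => u + f ((c ∘ s) p)) (l + 1 + 1) with hV'
        -- This is (s − x)(s + x) = 1 − x², with s + x carried through the chain by the intertwiner.
        have hVV : (1 - f x * f x) • V = V' * (P s + f x • 1) := by
          rw [hV', mul_assoc, ← inter, ← mul_assoc, hΦw', hV, ← smul_mul_assoc]
          congr 1
          rw [sub_mul, mul_add, mul_assoc, hss, smul_mul_assoc, mul_add, mul_smul_comm, mul_smul_comm]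
          simp only [mul_one]
          module
        -- The known equality V J_l = a V is rewritten in terms of V', where also V' J_l = b V'.
        -- With x (b − a) = 1 it yields V' J_{l+1} = a V', and transporting that back through s + x
        -- gives V J_{l+1} = b V.
        have e1 : V' * (P s * jucysMurphy P ⟨l, hl⟩) + f x • (f b • V') =
            f a • (V' * P s + f x • V') := by
          have := congrArg (fun z => (1 - f x * f x) • z) lowV
          rw [smul_comm _ (f a), ← smul_mul_assoc, hVV] at this
          simpa only [mul_add, add_mul, mul_smul_comm, smul_mul_assoc, mul_one, mul_assoc,
            low'] using this
        have e2 : V' * (jucysMurphy P ⟨l + 1, hm⟩ * P s) = f a • (V' * P s) := by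
          rw [J1, mul_add, mul_one, eq_sub_of_add_eq e1]
          match_scalars
          · ring
          · linear_combination -hxba
        have e3 : V' * jucysMurphy P ⟨l + 1, hm⟩ = f a • V' := by
          have := congrArg (· * P s) e2
          simpa only [mul_assoc, hss, mul_one, smul_mul_assoc] using this
        have e4 : (1 - f x * f x) • (V * jucysMurphy P ⟨l + 1, hm⟩) =
            (1 - f x * f x) • (f b • V) := by
          rw [← smul_mul_assoc, smul_comm _ (f b), hVV, mul_assoc, add_mul, J2, mul_add, mul_add,
            ← mul_assoc, low', mul_add, smul_mul_assoc, smul_mul_assoc, mul_smul_comm, one_mul, e3,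
            mul_smul_comm, mul_one]
          match_scalars
          · ring
          · linear_combination -hxba
        exact smul_right_injective A hfx e4

/-- The product of the sums of contractions equals the product of `R`-matrices. -/
theorem map_mul_prod_sumFactor (h : BrauerRelations P Q E η)
    (hu : ∀ r : ℝ, u + u + f r ≠ 0)
    (hinv : ∀ (σ : Equiv.Perm (Fin n)) (x y : W), inner ℂ (ρ σ x) (ρ σ y) = inner ℂ x y)
    {Φ : W →+ A} (hΦ : ∀ σ w, Φ (ρ σ w) * P σ = Φ w)
    (hΦs : ∀ (r : ℝ) w, Φ ((r : ℂ) • w) = f r • Φ w) (c : Fin n → ℝ) (w : W)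
    (hw : ∀ i : Fin n, jucysMurphy ρ i w = (c i : ℂ) • w) :
    Φ w * ((List.finRange n).map fun p => sumFactor Q E η u (fun p => f (c p)) p).prod =
      Φ w * ((List.finRange n).map fun p : Fin n => RProd Q (fun p => u + f (c p)) p (u + f (c p)) p *
        FMat E η (u + f (c p)) p).prod := by
  have key : ∀ k ≤ n, Φ w * (((List.finRange n).take k).map
      fun p => sumFactor Q E η u (fun p => f (c p)) p).prod =
      Φ w * chain Q E η (fun p => u + f (c p)) k := by
    intro k hk
    induction k with
    | zero => simp
    | succ k ih =>
      rw [h.mul_chain_succ hu _ c hk (h.map_mul_chain_mul_jucysMurphy hu hinv hΦ hΦs (by omega) c w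
        fun i _ => hw i), ← ih (by omega), take_finRange_succ hk]
      simp [mul_assoc]
  have := key n le_rfl
  rwa [chain, List.take_of_length_le (by simp)] at this

end Eigen

end BrauerRelations

/-! ### Counting pairs of boxes in a common row or column -/

section PairSums

variable {n : ℕ}

/-- Twice the sum over ordered pairs depends on h only through the pairs that h separates. This
allows one ordering to be traded for another. -/
theorem sum_lt_add_self {M L : Type*} [AddCommMonoid M] [LinearOrder L] {h : Fin n → L}
    {g : Fin n → Fin n → M} (hg : ∀ q k, g q k = g k q) :
    (∑ k, ∑ q, if h q < h k then g q k else 0) + (∑ k, ∑ q, if h q < h k then g q k else 0) =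
      ∑ k, ∑ q, if h q ≠ h k then g q k else 0 := by
  conv_lhs =>
    arg 1
    rw [Finset.sum_comm]
  simp only [← Finset.sum_add_distrib]
  refine Finset.sum_congr rfl fun k _ => Finset.sum_congr rfl fun q _ => ?_
  rw [hg k q]
  rcases lt_trichotomy (h q) (h k) with hlt | heq | hlt
  · rw [if_neg hlt.not_gt, if_pos hlt, if_pos hlt.ne, zero_add]
  · rw [heq, if_neg (lt_irrefl _), if_neg (not_not.2 rfl), zero_add]
  · rw [if_pos hlt, if_neg hlt.not_gt, if_pos hlt.ne', add_zero]

theorem sum_Iio_eq {M : Type*} [AddCommMonoid M] (g : Fin n → Fin n → M) :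
    ∑ k, ∑ q ∈ Finset.Iio k, g q k = ∑ k, ∑ q, if q < k then g q k else 0 := by
  refine Finset.sum_congr rfl fun k _ => ?_
  rw [← Finset.sum_filter]
  exact Finset.sum_congr (by ext; simp) fun _ _ => rfl

/-- Within a row, ordering by entry may be replaced by ordering by column. A box in column j then
has exactly j predecessors. -/
theorem sum_lt_indicator {r c : Fin n → ℕ} (hinj : ∀ q k, r q = r k → c q = c k → q = k)
    (hex : ∀ k, ∀ j < c k, ∃ q, r q = r k ∧ c q = j) :
    ∑ k, ∑ q ∈ Finset.Iio k, (if r q = r k then (1 : ℂ) else 0) = ∑ k, (c k : ℂ) := by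
  have h1 := sum_lt_add_self (h := id) (g := fun q k => if r q = r k then (1 : ℂ) else 0)
    fun q k => by simp only [eq_comm]
  have h2 := sum_lt_add_self (h := c) (g := fun q k => if r q = r k then (1 : ℂ) else 0)
    fun q k => by simp only [eq_comm]
  have h3 : ∀ k, (∑ q, if c q < c k then (if r q = r k then (1 : ℂ) else 0) else 0) = c k := by
    intro k
    have : (∑ q, if c q < c k then (if r q = r k then (1 : ℂ) else 0) else 0) =
        ((Finset.univ.filter fun q => c q < c k ∧ r q = r k).card : ℂ) := by
      simp only [← ite_and, Finset.sum_boole]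
    rw [this]
    have hc : (Finset.univ.filter fun q => c q < c k ∧ r q = r k).card =
        (Finset.range (c k)).card := by
      refine Finset.card_nbij c ?_ ?_ ?_
      · intro q hq; simpa using (by simpa using hq : _ ∧ _).1
      · intro q hq q' hq' e
        have hq : c q < c k ∧ r q = r k := by simpa using hq
        have hq' : c q' < c k ∧ r q' = r k := by simpa using hq'
        exact hinj _ _ (hq.2.trans hq'.2.symm) e
      · intro j hj
        have hj : j < c k := by simpa using hj
        obtain ⟨q, hq, rfl⟩ := hex k j hj
        exact ⟨q, by simpa using ⟨hj, hq⟩, rfl⟩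
    rw [hc, Finset.card_range]
  rw [sum_Iio_eq]
  have h4 : (∑ k, ∑ q, if id q ≠ id k then (if r q = r k then (1 : ℂ) else 0) else 0) =
      ∑ k, ∑ q, if c q ≠ c k then (if r q = r k then (1 : ℂ) else 0) else 0 := by
    refine Finset.sum_congr rfl fun k _ => Finset.sum_congr rfl fun q _ => ?_
    by_cases hr : r q = r k
    · have : id q ≠ id k ↔ c q ≠ c k :=
        not_congr ⟨fun e => congrArg c e, fun e => hinj _ _ hr e⟩
      simp only [this]
    · simp [hr]
  simp only [h3] at h2
  simp only [id] at h1 h4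
  rw [h4, ← h2] at h1
  linear_combination h1 / 2

end PairSums

/-! ### The sum of all transpositions on Specht modules -/

section YoungSymmetrizer

theorem eq_zero_of_eq_neg {M : Type*} [AddCommGroup M] [Module ℂ M] {x : M} (h : x = -x) :
    x = 0 := by
  have h2 : (2 : ℂ) • x = 0 := by
    rw [two_smul]
    nth_rewrite 2 [h]
    exact add_neg_cancel x
  exact (smul_eq_zero.1 h2).resolve_left two_ne_zero

variable {n : ℕ}

theorem sum_fiberwise_mul_single {f : Fin n → ℕ} {g : Equiv.Perm (Fin n)}
    (hg : ∀ q, f (g q) = f q) :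
    (∑ σ : Equiv.Perm (Fin n) with ∀ q, f (σ q) = f q, MonoidAlgebra.single σ (1 : ℂ)) *
      MonoidAlgebra.single g 1 =
    ∑ σ : Equiv.Perm (Fin n) with ∀ q, f (σ q) = f q, MonoidAlgebra.single σ (1 : ℂ) := by
  rw [Finset.sum_mul]
  refine Finset.sum_equiv (Equiv.mulRight g) (fun σ => ?_) fun σ _ => ?_
  · simp only [Finset.mem_filter, Finset.mem_univ, true_and, Equiv.coe_mulRight,
      Equiv.Perm.mul_apply]
    refine ⟨fun h q => by rw [h, hg], fun h q => ?_⟩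
    have := h (g.symm q)
    rwa [Equiv.apply_symm_apply, ← hg (g.symm q), Equiv.apply_symm_apply] at this
  · rw [MonoidAlgebra.single_mul_single, mul_one, Equiv.coe_mulRight]

theorem single_mul_sum_fiberwise_sign {f : Fin n → ℕ} {g : Equiv.Perm (Fin n)}
    (hg : ∀ q, f (g q) = f q) :
    MonoidAlgebra.single g (1 : ℂ) * (∑ σ : Equiv.Perm (Fin n) with ∀ q, f (σ q) = f q,
        MonoidAlgebra.single σ ((Equiv.Perm.sign σ : ℤ) : ℂ)) =
    ((Equiv.Perm.sign g : ℤ) : ℂ) • ∑ σ : Equiv.Perm (Fin n) with ∀ q, f (σ q) = f q,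
        MonoidAlgebra.single σ ((Equiv.Perm.sign σ : ℤ) : ℂ) := by
  rw [Finset.mul_sum, Finset.smul_sum]
  refine Finset.sum_equiv (Equiv.mulLeft g) (fun σ => ?_) fun σ _ => ?_
  · simp only [Finset.mem_filter, Finset.mem_univ, true_and, Equiv.coe_mulLeft,
      Equiv.Perm.mul_apply, hg]
  · have e : ((Equiv.Perm.sign g : ℤ) : ℂ) * ((Equiv.Perm.sign g : ℤ) : ℂ) = 1 := by
      rw [← Int.cast_mul, ← Units.val_mul, Int.units_mul_self]; simp
    rw [MonoidAlgebra.single_mul_single, one_mul, Equiv.coe_mulLeft, MonoidAlgebra.smul_single,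
      map_mul, Units.val_mul, Int.cast_mul, smul_eq_mul, ← mul_assoc, e, one_mul]

open BrauerRelations (jucysMurphy)

/-- The sum of all transpositions. -/
noncomputable def transpositionSum {B : Type*} [Ring B] (P : Equiv.Perm (Fin n) →* B) : B :=
  ∑ k, jucysMurphy P k

/-- Invariance under conjugation is visible only after doubling, when the sum runs over all q ≠ k
and no longer refers to the order. -/
theorem transpositionSum_comm (z : MonoidAlgebra ℂ (Equiv.Perm (Fin n))) :
    Commute (transpositionSum (MonoidAlgebra.of ℂ (Equiv.Perm (Fin n)))) z := by
  set P := MonoidAlgebra.of ℂ (Equiv.Perm (Fin n))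
  have h2 := sum_lt_add_self (h := id) (g := fun q k : Fin n => P (Equiv.swap q k))
    fun q k => by rw [Equiv.swap_comm]
  have hC : (2 : ℂ) • transpositionSum P =
      ∑ k : Fin n, ∑ q : Fin n, if q ≠ k then P (Equiv.swap q k) else 0 := by
    unfold transpositionSum jucysMurphy
    rw [two_smul, sum_Iio_eq]
    exact h2
  have hσ : ∀ σ, Commute (P σ) ((2 : ℂ) • transpositionSum P) := by
    intro σ
    rw [hC]
    unfold Commute SemiconjBy
    rw [Finset.mul_sum, Finset.sum_mul]
    refine Finset.sum_equiv σ (by simp) fun k _ => ?_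
    rw [Finset.mul_sum, Finset.sum_mul]
    refine Finset.sum_equiv σ (by simp) fun q _ => ?_
    by_cases h : q = k
    · simp [h]
    · rw [if_pos h, if_pos (by simpa using h), ← map_mul, ← map_mul, Equiv.mul_swap_eq_swap_mul]
  have hz : Commute z ((2 : ℂ) • transpositionSum P) := by
    induction z using MonoidAlgebra.induction_on with
    | of g => exact hσ g
    | add x y hx hy => exact hx.add_left hy
    | smul r x hx => exact hx.smul_left r
  have := (hz.smul_right ((2 : ℂ)⁻¹)).symm
  rwa [smul_smul, inv_mul_cancel₀ two_ne_zero, one_smul] at this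

variable {ω : YoungDiagram} (t : Fin n ≃ {x : ℕ × ℕ // x ∈ ω.cells})

/-- A transposition within a row is absorbed by the row sum, one within a column by the signed
column sum with sign −1. Any other one gives zero, since the product equals its own negative. -/
theorem transposition_youngSymmetrizer {i j : Fin n} (hij : i ≠ j) :
    (∑ σ : Equiv.Perm (Fin n) with ∀ q, (t (σ q)).1.1 = (t q).1.1,
        MonoidAlgebra.single σ (1 : ℂ)) * (MonoidAlgebra.single (Equiv.swap i j) (1 : ℂ) *
      (∑ σ : Equiv.Perm (Fin n) with ∀ q, (t (σ q)).1.2 = (t q).1.2,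
        MonoidAlgebra.single σ ((Equiv.Perm.sign σ : ℤ) : ℂ))) =
    ((if (t i).1.1 = (t j).1.1 then (1 : ℂ) else 0) -
      (if (t i).1.2 = (t j).1.2 then (1 : ℂ) else 0)) • youngSymmetrizer t := by
  have hswap : ∀ {f : Fin n → ℕ} {i j : Fin n}, f i = f j → ∀ q, f (Equiv.swap i j q) = f q := by
    intro f i j h q
    rw [Equiv.swap_apply_def]
    split_ifs with h1 h2
    · rw [h1, h]
    · rw [h2, h]
    · rfl
  have hrow : ∀ {i j : Fin n}, (t i).1.1 = (t j).1.1 → _ := fun {i j} h =>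
    sum_fiberwise_mul_single (f := fun q => (t q).1.1) (g := Equiv.swap i j)
      (hswap (f := fun q => (t q).1.1) h)
  have hcol : ∀ {i j : Fin n}, (t i).1.2 = (t j).1.2 → _ := fun {i j} h =>
    single_mul_sum_fiberwise_sign (f := fun q => (t q).1.2) (g := Equiv.swap i j)
      (hswap (f := fun q => (t q).1.2) h)
  unfold youngSymmetrizer
  by_cases h1 : (t i).1.1 = (t j).1.1
  · have h2 : (t i).1.2 ≠ (t j).1.2 := fun h2 =>
      hij (t.injective (Subtype.ext (Prod.ext h1 h2)))
    rw [if_pos h1, if_neg h2, sub_zero, one_smul, ← mul_assoc, hrow h1]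
  by_cases h2 : (t i).1.2 = (t j).1.2
  · rw [if_neg h1, if_pos h2, hcol h2, Equiv.Perm.sign_swap hij, mul_smul_comm]
    simp
  rw [if_neg h1, if_neg h2, sub_zero, zero_smul]
  have main : ∀ {i j : Fin n}, i ≠ j → (t i).1.1 < (t j).1.1 → (t i).1.2 ≠ (t j).1.2 →
      (∑ σ : Equiv.Perm (Fin n) with ∀ q, (t (σ q)).1.1 = (t q).1.1,
        MonoidAlgebra.single σ (1 : ℂ)) * (MonoidAlgebra.single (Equiv.swap i j) 1 *
      (∑ σ : Equiv.Perm (Fin n) with ∀ q, (t (σ q)).1.2 = (t q).1.2,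
        MonoidAlgebra.single σ ((Equiv.Perm.sign σ : ℤ) : ℂ))) = 0 := by
    intro i j hij h1 h2
    have hm : ((t i).1.1, (t j).1.2) ∈ ω.cells :=
      ω.up_left_mem (i2 := (t j).1.1) (j2 := (t j).1.2) h1.le le_rfl (t j).2
    -- The entry k sits in the row of i and the column of j. The relation (i k)(i j) = (i j)(j k)
    -- then exchanges a row transposition for a column transposition of sign −1.
    obtain ⟨k, hk⟩ := t.surjective ⟨_, hm⟩
    have hk1 : (t i).1.1 = (t k).1.1 := by rw [hk]
    have hk2 : (t j).1.2 = (t k).1.2 := by rw [hk]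
    have hki : k ≠ i := by rintro rfl; exact h2 hk2.symm
    have hkj : k ≠ j := by rintro rfl; exact h1.ne hk1
    have e : MonoidAlgebra.single (Equiv.swap i k) (1 : ℂ) *
        MonoidAlgebra.single (Equiv.swap i j) 1 =
        MonoidAlgebra.single (Equiv.swap i j) 1 * MonoidAlgebra.single (Equiv.swap j k) 1 := by
      rw [MonoidAlgebra.single_mul_single, MonoidAlgebra.single_mul_single,
        Equiv.mul_swap_eq_swap_mul (Equiv.swap i j) j k, Equiv.swap_apply_right, Equiv.swap_apply_of_ne_of_ne hki hkj]
    refine eq_zero_of_eq_neg ?_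
    conv_lhs =>
      rw [← hrow hk1, mul_assoc, ← mul_assoc (MonoidAlgebra.single (Equiv.swap i k) _), e,
        mul_assoc, hcol hk2, Equiv.Perm.sign_swap hkj.symm]
    simp
  rcases lt_or_gt_of_ne h1 with h | h
  · exact main hij h h2
  · rw [Equiv.swap_comm]
    exact main hij.symm h (Ne.symm h2)

/-- Centrality moves the sum between the row and column factors, where each transposition acts by 1,
−1 or 0. The number of row pairs minus the number of column pairs is the sum of contents. -/
theorem transpositionSum_mul_youngSymmetrizer :
    transpositionSum (MonoidAlgebra.of ℂ (Equiv.Perm (Fin n))) * youngSymmetrizer t =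
      (∑ k, (((t k).1.2 : ℂ) - ((t k).1.1 : ℂ))) • youngSymmetrizer t := by
  have e : transpositionSum (MonoidAlgebra.of ℂ (Equiv.Perm (Fin n))) * youngSymmetrizer t =
    (∑ k : Fin n, ∑ q ∈ Finset.Iio k, ((if (t q).1.1 = (t k).1.1 then (1 : ℂ) else 0) -
      (if (t q).1.2 = (t k).1.2 then (1 : ℂ) else 0))) • youngSymmetrizer t := by
    conv_lhs => rw [youngSymmetrizer, ← mul_assoc, (transpositionSum_comm _).eq, mul_assoc]
    have key := fun (i j : Fin n) (hij : i ≠ j) => transposition_youngSymmetrizer t hij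
    generalize (∑ σ : Equiv.Perm (Fin n) with ∀ q, (t (σ q)).1.1 = (t q).1.1,
      MonoidAlgebra.single σ (1 : ℂ)) = a at key ⊢
    unfold transpositionSum jucysMurphy
    rw [Finset.sum_mul, Finset.mul_sum, Finset.sum_smul]
    refine Finset.sum_congr rfl fun k _ => ?_
    rw [Finset.sum_mul, Finset.mul_sum, Finset.sum_smul]
    refine Finset.sum_congr rfl fun q hq => ?_
    have hq : q < k := by simpa using hq
    exact key q k hq.ne
  rw [e]
  congr 1
  simp only [Finset.sum_sub_distrib]
  rw [sum_lt_indicator (r := fun k => (t k).1.1) (c := fun k => (t k).1.2)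
      (fun q k h1 h2 => t.injective (Subtype.ext (Prod.ext h1 h2))),
    sum_lt_indicator (r := fun k => (t k).1.2) (c := fun k => (t k).1.1)
      (fun q k h1 h2 => t.injective (Subtype.ext (Prod.ext h2 h1)))]
  · intro k j hj
    obtain ⟨q, hq⟩ := t.surjective ⟨(j, (t k).1.2), ω.up_left_mem hj.le le_rfl (t k).2⟩
    exact ⟨q, by simp [hq], by simp [hq]⟩
  · intro k j hj
    obtain ⟨q, hq⟩ := t.surjective ⟨((t k).1.1, j), ω.up_left_mem le_rfl hj.le (t k).2⟩
    exact ⟨q, by simp [hq], by simp [hq]⟩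

theorem sum_swap_spechtRep
    (x : (Ideal.span {youngSymmetrizer t} : Ideal (MonoidAlgebra ℂ (Equiv.Perm (Fin n))))) :
    ∑ k, ∑ q ∈ Finset.Iio k, spechtRep t (Equiv.swap q k) x =
      (∑ k, (((t k).1.2 : ℂ) - ((t k).1.1 : ℂ))) • x := by
  have e : ((∑ k, ∑ q ∈ Finset.Iio k, spechtRep t (Equiv.swap q k) x :
      (Ideal.span {youngSymmetrizer t} : Ideal (MonoidAlgebra ℂ (Equiv.Perm (Fin n))))) :
        MonoidAlgebra ℂ (Equiv.Perm (Fin n))) =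
      transpositionSum (MonoidAlgebra.of ℂ (Equiv.Perm (Fin n))) * x := by
    unfold transpositionSum jucysMurphy
    simp only [Finset.sum_mul, AddSubmonoidClass.coe_finsetSum]
    refine Finset.sum_congr rfl fun k _ => Finset.sum_congr rfl fun q _ => ?_
    simp [spechtRep, Representation.ofModule']
  obtain ⟨x, hx⟩ := x
  obtain ⟨z, rfl⟩ := Ideal.mem_span_singleton'.1 hx
  refine Subtype.ext (e.trans ?_)
  change _ * (z * _) = _ • (z * _)
  rw [← mul_assoc, (transpositionSum_comm z).eq, mul_assoc, transpositionSum_mul_youngSymmetrizer,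
    mul_smul_comm]

end YoungSymmetrizer

/-! ### Contents as Jucys–Murphy eigenvalues of a Young vector -/

section YoungVector

variable {n : ℕ} {ν : YoungDiagram} {T : StandardTableau ν n}
  {W : Type*} [NormedAddCommGroup W] [InnerProductSpace ℂ W]
  {ρ : Representation ℂ (Equiv.Perm (Fin n)) W} {w : W}

open BrauerRelations (jucysMurphy)

theorem restrictFirst_swap {p : ℕ} (hp : p ≤ n) (q k : Fin p) :
    restrictFirst hp ρ (Equiv.swap q k) =
      ρ (Equiv.swap (Fin.castLE hp q) (Fin.castLE hp k)) := by
  change ρ (Equiv.Perm.viaEmbeddingHom _ _) = _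
  congr 1
  rw [Equiv.Perm.viaEmbeddingHom_apply]
  ext1 x
  by_cases hx : x ∈ Set.range (Fin.castLEEmb hp)
  · obtain ⟨y, rfl⟩ := hx
    rw [Equiv.Perm.viaEmbedding_apply]
    exact ((Fin.castLEEmb hp).injective.map_swap q k y)
  · rw [Equiv.Perm.viaEmbedding_apply_of_notMem _ _ _ hx, Equiv.swap_apply_of_ne_of_ne]
    · rintro rfl; exact hx ⟨q, rfl⟩
    · rintro rfl; exact hx ⟨k, rfl⟩

theorem sum_jucysMurphy_of_isIrrepOfShape {p : ℕ} (hp : p ≤ n)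
    {U : Subrepresentation (restrictFirst hp ρ)} (hwU : w ∈ U)
    (hU : IsIrrepOfShape U.toRepresentation (T.shape p)) :
    ∑ k : Fin p, jucysMurphy ρ (Fin.castLE hp k) w =
      (∑ k : Fin p, (T.content (Fin.castLE hp k) : ℂ)) • w := by
  obtain ⟨t, ⟨e⟩⟩ := hU
  have h1 := congrArg e.toIntertwiningMap
    (sum_swap_spechtRep t (e.toLinearEquiv.symm ⟨w, hwU⟩))
  simp only [map_sum, map_smul, e.toIntertwiningMap.isIntertwining] at h1
  have h0 : e.toIntertwiningMap (e.toLinearEquiv.symm ⟨w, hwU⟩) = ⟨w, hwU⟩ :=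
    e.toLinearEquiv.apply_symm_apply _
  rw [h0] at h1
  have h2 := congrArg Subtype.val h1
  simp only [AddSubmonoidClass.coe_finsetSum] at h2
  -- The sum of contents depends on the set of boxes and not on the filling, so t may be replaced by
  -- the first p entries of T.
  have hc : ∑ k, (((t k).1.2 : ℂ) - ((t k).1.1 : ℂ)) =
      ∑ k : Fin p, (T.content (Fin.castLE hp k) : ℂ) := by
    rw [t.sum_comp fun x => ((x.1.2 : ℂ) - (x.1.1 : ℂ)),
      Finset.sum_coe_sort (T.shape p).cells fun x => ((x.2 : ℂ) - (x.1 : ℂ)), StandardTableau.shape,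
      Finset.sum_image fun q _ r _ h => T.box.injective (Subtype.ext h)]
    symm
    refine Finset.sum_bij (fun k _ => Fin.castLE hp k) (by simp) (by simp) ?_ ?_
    · intro q hq
      exact ⟨⟨q, by simpa using hq⟩, by simp, rfl⟩
    · intro k _
      simp [StandardTableau.content]
  rw [← hc]
  refine Eq.trans ?_ h2
  refine Finset.sum_congr rfl fun k _ => ?_
  rw [jucysMurphy, LinearMap.sum_apply]
  symm
  refine Finset.sum_bij (fun q _ => Fin.castLE hp q) ?_ ?_ ?_ ?_
  · intro q hq
    rw [Finset.mem_Iio, Fin.lt_def] at hq ⊢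
    exact hq
  · intro q _ r _ h
    simpa using h
  · intro q hq
    have hq : (q : ℕ) < k := Fin.lt_def.1 (Finset.mem_Iio.1 hq)
    exact ⟨⟨q, hq.trans k.2⟩, Finset.mem_Iio.2 hq, rfl⟩
  · intro q _
    rw [← restrictFirst_swap]
    rfl

/-- The operator is the difference of the transposition sums of S_{k+1} and S_k, and the shapes
differ by the box of the entry k. -/
theorem IsYoungVector.jucysMurphy_apply (hw : IsYoungVector T ρ w) (k : Fin n) :
    jucysMurphy ρ k w = ((T.content k : ℝ) : ℂ) • w := by
  have key : ∀ p (hp : p ≤ n), ∑ k : Fin p, jucysMurphy ρ (Fin.castLE hp k) w =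
      (∑ k : Fin p, (T.content (Fin.castLE hp k) : ℂ)) • w := by
    intro p hp
    obtain ⟨U, hwU, hU⟩ := hw.2 p hp
    exact sum_jucysMurphy_of_isIrrepOfShape hp hwU hU
  have h1 := key (k + 1) k.2
  rw [Fin.sum_univ_castSucc, Fin.sum_univ_castSucc, add_smul] at h1
  have h2 := key k k.2.le
  change ∑ i : Fin k, jucysMurphy ρ (Fin.castLE k.2.le i) w + jucysMurphy ρ k w =
    (∑ i : Fin k, (T.content (Fin.castLE k.2.le i) : ℂ)) • w + (T.content k : ℂ) • w at h1
  rw [h2] at h1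
  simpa using add_left_cancel h1

end YoungVector

/-! ### Calculus of tensor legs -/

section Legs

theorem eq_comp_symm_iff {I : Type*} {n : ℕ} {σ : Equiv.Perm (Fin n)} {i j : Fin n → I} :
    i = j ∘ σ.symm ↔ j = i ∘ σ := by
  constructor <;> rintro rfl <;> ext <;> simp

theorem kronecker_entry {I R : Type*} [Mul R] (X Y : Matrix I I R) (a b : I × I) :
    Matrix.kronecker X Y a b = X a.1 b.1 * Y a.2 b.2 := rfl

variable {I R S : Type*} [DecidableEq I] {n : ℕ}

/-- Allowing coinciding legs brings a single leg under the conjugation and commutation lemmas for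
two legs, which do not require p ≠ q. -/
theorem leg_eq_leg₂_self [Zero R] (p : Fin n) (X : Matrix I I R) :
    leg p X = leg₂ p p (Matrix.of fun a b : I × I => X a.1 b.1) := by
  ext i j
  simp [leg, leg₂]

/-- Padding with an identity on a second leg reduces relations between two legs to identities of
matrices over I × I. -/
theorem leg_eq_leg₂_left [Semiring R] {p q : Fin n} (hpq : p ≠ q) (X : Matrix I I R) :
    leg p X = leg₂ p q (Matrix.kronecker X (1 : Matrix I I R)) := by
  ext i j
  simp only [leg, leg₂, Matrix.of_apply, kronecker_entry, Matrix.one_apply, mul_ite, mul_one,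
    mul_zero, ← ite_and]
  refine if_congr ⟨fun h => ⟨fun r h1 _ => h r h1, h q hpq.symm⟩, fun h r h1 => ?_⟩ rfl rfl
  by_cases hr : r = q
  · rw [hr, h.2]
  · exact h.1 r h1 hr

theorem leg_eq_leg₂_right [Semiring R] {p q : Fin n} (hpq : p ≠ q) (X : Matrix I I R) :
    leg q X = leg₂ p q (Matrix.kronecker (1 : Matrix I I R) X) := by
  ext i j
  simp only [leg, leg₂, Matrix.of_apply, kronecker_entry, Matrix.one_apply, ite_mul, one_mul,
    zero_mul, ← ite_and]
  refine if_congr ⟨fun h => ⟨fun r _ h1 => h r h1, h p hpq⟩, fun h r h1 => ?_⟩ rfl rfl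
  by_cases hr : r = p
  · rw [hr, h.2]
  · exact h.1 r hr h1

theorem leg₂_map [Zero R] [Zero S] (f : R → S) (hf : f 0 = 0) (p q : Fin n)
    (X : Matrix (I × I) (I × I) R) : (leg₂ p q X).map f = leg₂ p q (X.map f) := by
  ext i j
  simp only [leg₂, Matrix.map_apply, Matrix.of_apply]
  split_ifs <;> simp [hf]

theorem leg_one [Semiring R] (p : Fin n) : leg p (1 : Matrix I I R) = 1 := by
  ext i j
  simp only [leg, Matrix.of_apply, Matrix.one_apply, ← ite_and]
  refine if_congr ⟨fun h => funext fun r => ?_, fun h => by simp [h]⟩ rfl rfl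
  by_cases hr : r = p
  · rw [hr, h.2]
  · exact h.1 r hr

theorem leg₂_one [Semiring R] {p q : Fin n} (hpq : p ≠ q) :
    leg₂ p q (1 : Matrix (I × I) (I × I) R) = 1 := by
  rw [← leg_one p, leg_eq_leg₂_left hpq]
  exact congrArg _ Matrix.one_kronecker_one.symm

theorem leg_add [AddMonoid R] (p : Fin n) (X Y : Matrix I I R) :
    leg p (X + Y) = leg p X + leg p Y := by
  ext i j
  simp only [leg, Matrix.add_apply, Matrix.of_apply]
  split_ifs <;> simp

theorem leg_smul [Zero R] [SMulZeroClass S R] (p : Fin n) (s : S) (X : Matrix I I R) :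
    leg p (s • X) = s • leg p X := by
  ext i j
  simp only [leg, Matrix.smul_apply, Matrix.of_apply]
  split_ifs <;> simp

theorem leg₂_add [AddMonoid R] (p q : Fin n) (X Y : Matrix (I × I) (I × I) R) :
    leg₂ p q (X + Y) = leg₂ p q X + leg₂ p q Y := by
  ext i j
  simp only [leg₂, Matrix.add_apply, Matrix.of_apply]
  split_ifs <;> simp

theorem leg₂_smul [Zero R] [SMulZeroClass S R] (p q : Fin n) (s : S)
    (X : Matrix (I × I) (I × I) R) : leg₂ p q (s • X) = s • leg₂ p q X := by
  ext i j
  simp only [leg₂, Matrix.smul_apply, Matrix.of_apply]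
  split_ifs <;> simp

theorem leg₂_sub [AddGroup R] (p q : Fin n) (X Y : Matrix (I × I) (I × I) R) :
    leg₂ p q (X - Y) = leg₂ p q X - leg₂ p q Y := by
  ext i j
  simp only [leg₂, Matrix.sub_apply, Matrix.of_apply]
  split_ifs <;> simp

theorem leg₂_neg [AddGroup R] (p q : Fin n) (X : Matrix (I × I) (I × I) R) :
    leg₂ p q (-X) = -leg₂ p q X := by
  ext i j
  simp only [leg₂, Matrix.neg_apply, Matrix.of_apply]
  split_ifs <;> simp

/-- The matrix that permutes the tensor factors, with entries in any semiring. -/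
def permuteMatrix (I R : Type*) [DecidableEq I] [Semiring R] {n : ℕ}
    (σ : Equiv.Perm (Fin n)) : Matrix (Fin n → I) (Fin n → I) R :=
  Matrix.of fun i j => if i = j ∘ σ.symm then 1 else 0

/-- The flip of the two factors of `ℂ^I ⊗ ℂ^I`. -/
def flipMatrix (I R : Type*) [DecidableEq I] [Semiring R] : Matrix (I × I) (I × I) R :=
  Matrix.of fun a b => if a.swap = b then 1 else 0

theorem permuteMatrix_swap [Semiring R] (p q : Fin n) :
    permuteMatrix I R (Equiv.swap p q) = leg₂ p q (flipMatrix I R) := by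
  ext i j
  simp only [permuteMatrix, leg₂, flipMatrix, Matrix.of_apply, ← ite_and]
  refine if_congr ?_ rfl rfl
  constructor
  · rintro rfl
    refine ⟨fun r h1 h2 => ?_, ?_⟩
    · simp [Equiv.swap_apply_of_ne_of_ne h1 h2]
    · simp
  · rintro ⟨h, e⟩
    have e1 : i q = j p := congrArg Prod.fst e
    have e2 : i p = j q := congrArg Prod.snd e
    ext r
    rw [Function.comp_apply, Equiv.symm_swap, Equiv.swap_apply_def]
    split_ifs with h1 h2
    · rw [h1, e2]
    · rw [h2, e1]
    · rw [h r h1 h2]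

variable [Fintype I]

theorem leg₂_mul_apply [Semiring R] {p q : Fin n} (hpq : p ≠ q) (X : Matrix (I × I) (I × I) R)
    (M : Matrix (Fin n → I) (Fin n → I) R) (i j : Fin n → I) :
    (leg₂ p q X * M) i j = ∑ a : I × I,
      X (i p, i q) a * M (Function.update (Function.update i p a.1) q a.2) j := by
  rw [Matrix.mul_apply]
  simp only [leg₂, Matrix.of_apply, ite_mul, zero_mul]
  rw [← Finset.sum_filter]
  symm
  refine Finset.sum_bij (fun a _ => Function.update (Function.update i p a.1) q a.2) ?_ ?_ ?_ ?_
  · intro a _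
    simp +contextual [Function.update_of_ne]
  · intro a _ b _ h
    have h1 := congrFun h p
    have h2 := congrFun h q
    simp only [Function.update_of_ne hpq, Function.update_self] at h1 h2
    exact Prod.ext h1 h2
  · intro k hk
    have hk : ∀ r, r ≠ p → r ≠ q → i r = k r := by simpa using hk
    refine ⟨(k p, k q), Finset.mem_univ _, funext fun r => ?_⟩
    by_cases hq : r = q
    · rw [hq, Function.update_self]
    · by_cases hp : r = p
      · rw [Function.update_of_ne hq, hp, Function.update_self]
      · rw [Function.update_of_ne hq, Function.update_of_ne hp, hk r hp hq]
  · intro a _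
    simp [Function.update_of_ne hpq]

theorem leg₂_mul [Semiring R] {p q : Fin n} (hpq : p ≠ q) (X Y : Matrix (I × I) (I × I) R) :
    leg₂ p q X * leg₂ p q Y = leg₂ p q (X * Y) := by
  ext i j
  rw [leg₂_mul_apply hpq]
  have h : ∀ a : I × I, (∀ r, r ≠ p → r ≠ q →
      Function.update (Function.update i p a.1) q a.2 r = j r) ↔
      ∀ r, r ≠ p → r ≠ q → i r = j r := fun a =>
    forall_congr' fun r => forall_congr' fun h1 => forall_congr' fun h2 => by
      rw [Function.update_of_ne h2, Function.update_of_ne h1]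
  simp only [leg₂, Matrix.of_apply, h, Matrix.mul_apply, Function.update_self,
    Function.update_of_ne hpq]
  split_ifs <;> simp

theorem leg₂_mul_disjoint_apply [Semiring R] {p q r s : Fin n} (h1 : p ≠ r) (h2 : p ≠ s)
    (h3 : q ≠ r) (h4 : q ≠ s) (X Y : Matrix (I × I) (I × I) R) (i j : Fin n → I) :
    (leg₂ p q X * leg₂ r s Y) i j =
      if ∀ t, t ≠ p → t ≠ q → t ≠ r → t ≠ s → i t = j t then
        X (i p, i q) (j p, j q) * Y (i r, i s) (j r, j s) else 0 := by
  -- The only intermediate index that can contribute agrees with i on the legs r, s and with j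
  -- elsewhere.
  rw [Matrix.mul_apply, Finset.sum_eq_single fun t => if t = r ∨ t = s then i t else j t]
  · simp only [leg₂, Matrix.of_apply, h1, h2, h3, h4, or_self, if_false, true_or, or_true, if_true]
    have c1 : (∀ t, t ≠ p → t ≠ q → i t = if t = r ∨ t = s then i t else j t) ↔
        ∀ t, t ≠ p → t ≠ q → t ≠ r → t ≠ s → i t = j t := by
      refine forall_congr' fun t => forall_congr' fun _ => forall_congr' fun _ => ?_
      by_cases hr : t = r <;> by_cases hs : t = s <;> simp [hr, hs]
    have c2 : ∀ t, t ≠ r → t ≠ s → (if t = r ∨ t = s then i t else j t) = j t := by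
      intro t hr hs
      simp [hr, hs]
    simp only [c1]
    rw [if_pos c2]
    simp
  · intro k _ hk
    simp only [leg₂, Matrix.of_apply]
    by_cases hx : ∀ t, t ≠ p → t ≠ q → i t = k t
    · by_cases hy : ∀ t, t ≠ r → t ≠ s → k t = j t
      · refine absurd (funext fun t => ?_) hk
        by_cases hr : t = r
        · rw [if_pos (Or.inl hr), hx t (hr ▸ h1.symm) (hr ▸ h3.symm)]
        · by_cases hs : t = s
          · rw [if_pos (Or.inr hs), hx t (hs ▸ h2.symm) (hs ▸ h4.symm)]
          · rw [if_neg (by tauto), hy t hr hs]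
      · rw [if_neg hy, mul_zero]
    · rw [if_neg hx, zero_mul]
  · simp

theorem leg₂_commute [Semiring R] {p q r s : Fin n} (h1 : p ≠ r) (h2 : p ≠ s)
    (h3 : q ≠ r) (h4 : q ≠ s) {X Y : Matrix (I × I) (I × I) R}
    (hXY : ∀ a b c d, Commute (X a b) (Y c d)) : Commute (leg₂ p q X) (leg₂ r s Y) := by
  ext i j
  rw [leg₂_mul_disjoint_apply h1 h2 h3 h4,
    leg₂_mul_disjoint_apply h1.symm h3.symm h2.symm h4.symm, (hXY _ _ _ _).eq]
  refine if_congr ?_ rfl rfl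
  exact forall_congr' fun t => ⟨fun h a b c d => h c d a b, fun h a b c d => h c d a b⟩

theorem permuteMatrix_mul_apply [Semiring R] (σ : Equiv.Perm (Fin n))
    (M : Matrix (Fin n → I) (Fin n → I) R) (i j : Fin n → I) :
    (permuteMatrix I R σ * M) i j = M (i ∘ σ) j := by
  simp [permuteMatrix, Matrix.mul_apply, eq_comp_symm_iff]

theorem mul_permuteMatrix_apply [Semiring R] (σ : Equiv.Perm (Fin n))
    (M : Matrix (Fin n → I) (Fin n → I) R) (i j : Fin n → I) :
    (M * permuteMatrix I R σ) i j = M i (j ∘ σ.symm) := by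
  simp [permuteMatrix, Matrix.mul_apply]

theorem permuteMatrix_mul_leg₂ [Semiring R] (σ : Equiv.Perm (Fin n)) (p q : Fin n)
    (X : Matrix (I × I) (I × I) R) :
    permuteMatrix I R σ * leg₂ p q X = leg₂ (σ p) (σ q) X * permuteMatrix I R σ := by
  ext i j
  rw [permuteMatrix_mul_apply, mul_permuteMatrix_apply]
  simp only [leg₂, Matrix.of_apply, Function.comp_apply, Equiv.symm_apply_apply]
  refine if_congr ⟨fun h r h1 h2 => ?_, fun h r h1 h2 => ?_⟩ rfl rfl
  · have := h (σ.symm r) (fun e => h1 (by rw [← e, Equiv.apply_symm_apply]))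
      (fun e => h2 (by rw [← e, Equiv.apply_symm_apply]))
    rwa [Equiv.apply_symm_apply] at this
  · have := h (σ r) (fun e => h1 (σ.injective e)) (fun e => h2 (σ.injective e))
    rwa [Equiv.symm_apply_apply] at this

theorem flipMatrix_mul_apply [Semiring R] (X : Matrix (I × I) (I × I) R) (a b : I × I) :
    (flipMatrix I R * X) a b = X a.swap b := by
  simp [flipMatrix, Matrix.mul_apply]

theorem kronecker_one_mul_apply [Semiring R] (E : Matrix I I R) (X : Matrix (I × I) (I × I) R)
    (a b : I × I) : (Matrix.kronecker E (1 : Matrix I I R) * X) a b = ∑ e, E a.1 e * X (e, a.2) b := by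
  simp only [Matrix.mul_apply, kronecker_entry, Fintype.sum_prod_type, Matrix.one_apply, mul_ite,
    mul_one, mul_zero, ite_mul, zero_mul, Finset.sum_ite_eq, Finset.mem_univ, if_true]

theorem one_kronecker_mul_apply [Semiring R] (E : Matrix I I R) (X : Matrix (I × I) (I × I) R)
    (a b : I × I) : (Matrix.kronecker (1 : Matrix I I R) E * X) a b = ∑ e, E a.2 e * X (a.1, e) b := by
  rw [Matrix.mul_apply, Fintype.sum_prod_type, Finset.sum_comm]
  simp only [kronecker_entry, Matrix.one_apply, one_mul, zero_mul, ite_mul, Finset.sum_ite_eq,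
    Finset.mem_univ, if_true]

theorem mul_kronecker_one_apply [Semiring R] (E : Matrix I I R) (X : Matrix (I × I) (I × I) R)
    (a b : I × I) : (X * Matrix.kronecker E (1 : Matrix I I R)) a b = ∑ e, X a (e, b.2) * E e b.1 := by
  simp only [Matrix.mul_apply, kronecker_entry, Fintype.sum_prod_type, Matrix.one_apply, mul_ite,
    mul_one, mul_zero, Finset.sum_ite_eq', Finset.mem_univ, if_true]

theorem mul_one_kronecker_apply [Semiring R] (E : Matrix I I R) (X : Matrix (I × I) (I × I) R)
    (a b : I × I) : (X * Matrix.kronecker (1 : Matrix I I R) E) a b = ∑ e, X a (b.1, e) * E e b.2 := by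
  rw [Matrix.mul_apply, Fintype.sum_prod_type, Finset.sum_comm]
  simp only [kronecker_entry, Matrix.one_apply, one_mul, zero_mul, ite_mul, mul_ite, mul_zero,
    Finset.sum_ite_eq', Finset.mem_univ, if_true]

end Legs

/-! ### Structure constants of the orthogonal and symplectic Lie algebras -/

namespace ClassicalGroup

variable (G : ClassicalGroup)

theorem Q_apply (a b : G.Idx × G.Idx) :
    G.Q a b = if a.2 = -a.1 ∧ b.2 = -b.1 then G.eps a.1 b.1 else 0 := by
  obtain ⟨a1, a2⟩ := a
  obtain ⟨b1, b2⟩ := b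
  simp only [Q, Matrix.sum_apply, Matrix.smul_apply, kronecker_entry, Matrix.single_apply]
  rw [Finset.sum_eq_single a1, Finset.sum_eq_single b1]
  · simp [eq_comm]
  · intro j _ hj; simp [hj]
  · simp
  · intro i _ hi
    refine Finset.sum_eq_zero fun j _ => ?_
    simp [hi]
  · simp

theorem neg_eq_iff {i j : G.Idx} : -i = j ↔ i = -j := by
  constructor <;> rintro rfl <;> rw [neg_neg_idx]

/-- The number 2η = ±1 records whether the form is symmetric or alternating. With this rule the two
cases are treated together. -/
theorem sgn_neg (i : G.Idx) : G.sgn (-i) = 2 * G.eta * G.sgn i := by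
  cases G with
  | O N => simp [sgn, eta]
  | Sp M =>
    have h : ∀ k : (Sp M).Idx, (-k).1 = -k.1 := fun _ => rfl
    simp [sgn, eta, h, Int.sign_neg]
    ring

theorem two_eta_sq : (2 * G.eta) * (2 * G.eta) = 1 := by
  cases G <;> norm_num [eta]

theorem FMatrix_neg_neg (i j : G.Idx) : G.FMatrix i j = -(G.eps i j • G.FMatrix (-j) (-i)) := by
  have h : G.eps i j * G.eps (-j) (-i) = 1 := by
    simp only [eps]
    rw [G.sgn_neg_mul j i]
    linear_combination G.sgn i * G.sgn i * G.sgn_mul_self j + G.sgn_mul_self i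
  simp only [FMatrix, neg_neg_idx, smul_sub, smul_smul, h, one_smul]
  abel

theorem FGen_neg_neg (i j : G.Idx) : G.FGen i j = -(G.eps i j • G.FGen (-j) (-i)) := by
  unfold FGen
  rw [← map_smul, ← map_neg]
  congr 1
  exact Subtype.ext (G.FMatrix_neg_neg i j)

/-- The four terms are grouped as in the matrix form of the relation: the first two give the flip
term, the last two the commutator with Q. -/
theorem FMatrix_commutator (a b c d : G.Idx) :
    G.FMatrix c a * G.FMatrix d b - G.FMatrix d b * G.FMatrix c a =
      (((if a = d then (1 : ℂ) else 0) • G.FMatrix c b -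
        (if b = c then (1 : ℂ) else 0) • G.FMatrix d a) +
        ((if d = -c then G.eps (-b) c else 0) • G.FMatrix (-b) a)) -
        (if b = -a then G.eps a (-d) else 0) • G.FMatrix c (-d) := by
  have hs : ∀ i j k l : G.Idx, (Matrix.single i j (1 : ℂ) : Matrix G.Idx G.Idx ℂ) *
      Matrix.single k l 1 = (if j = k then (1 : ℂ) else 0) • Matrix.single i l 1 := by
    intro i j k l
    split_ifs with h
    · rw [h, Matrix.single_mul_single_same, one_mul, one_smul]
    · rw [Matrix.single_mul_single_of_ne _ _ _ _ h, zero_smul]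
  have hn : ∀ i j : G.Idx, -i = -j ↔ i = j := fun i j => by rw [neg_eq_iff, neg_neg_idx]
  have e1 : a = -b ↔ b = -a := by rw [← G.neg_eq_iff, eq_comm]
  have e2 : -c = d ↔ d = -c := eq_comm
  have e3 : -d = c ↔ d = -c := G.neg_eq_iff
  have e4 : c = b ↔ b = c := eq_comm
  have e5 : d = a ↔ a = d := eq_comm
  simp only [FMatrix, neg_neg_idx, sub_mul, mul_sub, smul_mul_assoc, mul_smul_comm, hs, hn, e1, e2, e3,
    e4, e5, eps]
  clear e1 e2 e3 e4 e5
  have hη := G.two_eta_sq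
  match_scalars
  · rfl
  · split_ifs with h
    · rw [G.sgn_neg]
      linear_combination (G.sgn c * G.sgn a * G.sgn b * G.sgn b) * hη +
        G.sgn c * G.sgn a * G.sgn_mul_self b
    · ring
  · split_ifs with h
    · rw [h, G.sgn_neg, G.sgn_neg]; ring
    · ring
  · split_ifs with h
    · rw [h]
      linear_combination G.sgn d * G.sgn a * G.sgn_mul_self c
    · ring
  · rfl
  · split_ifs with h
    · rw [h, G.sgn_neg, G.sgn_neg]; ring
    · ring
  · split_ifs with h
    · linear_combination -G.sgn c * G.sgn a * G.sgn_mul_self (-d)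
    · ring
  · split_ifs with h
    · rw [h]
      linear_combination -G.sgn c * G.sgn b * G.sgn_mul_self d
    · ring

theorem FGen_commutator (a b c d : G.Idx) :
    G.FGen c a * G.FGen d b - G.FGen d b * G.FGen c a =
      (((if a = d then (1 : ℂ) else 0) • G.FGen c b -
        (if b = c then (1 : ℂ) else 0) • G.FGen d a) +
        ((if d = -c then G.eps (-b) c else 0) • G.FGen (-b) a)) -
        (if b = -a then G.eps a (-d) else 0) • G.FGen c (-d) := by
  unfold FGen
  rw [← LieRing.of_associative_ring_bracket, ← LieHom.map_lie]
  simp only [← map_smul, ← map_sub, ← map_add]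
  congr 1
  exact Subtype.ext (G.FMatrix_commutator a b c d)

end ClassicalGroup

/-! ### Verification of the Brauer relations -/

namespace ClassicalGroup

variable (G : ClassicalGroup) {R : Type*} [Ring R] [Algebra ℂ R] {n : ℕ}

theorem Q_swap_left (a b : G.Idx × G.Idx) :
    G.Q a.swap b = 2 * G.eta * G.Q a b := by
  rw [Q_apply, Q_apply]
  have h : a.swap.2 = -a.swap.1 ↔ a.2 = -a.1 := by
    rw [Prod.snd_swap, Prod.fst_swap, ← G.neg_eq_iff, eq_comm]
  simp only [h]
  split_ifs with h1
  · rw [eps, eps, Prod.fst_swap, h1.1, sgn_neg]; ring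
  · ring

/-- The contraction `Q` with entries in a `ℂ`-algebra. -/
noncomputable def QMap (R : Type*) [Ring R] [Algebra ℂ R] :
    Matrix (G.Idx × G.Idx) (G.Idx × G.Idx) R :=
  G.Q.map (algebraMap ℂ R)

theorem QMap_apply (a b : G.Idx × G.Idx) : G.QMap R a b = algebraMap ℂ R (G.Q a b) := rfl

theorem flipMatrix_mul_QMap :
    flipMatrix G.Idx R * G.QMap R = (2 * G.eta) • G.QMap R := by
  ext a b
  rw [flipMatrix_mul_apply, Matrix.smul_apply, QMap_apply, QMap_apply,
    Q_swap_left, map_mul, Algebra.smul_def]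

theorem Q_swap_swap (a b : G.Idx × G.Idx) : G.Q a.swap b.swap = G.Q a b := by
  have h : ∀ a : G.Idx × G.Idx, a.swap.2 = -a.swap.1 ↔ a.2 = -a.1 := fun a => by
    rw [Prod.snd_swap, Prod.fst_swap, ← G.neg_eq_iff, eq_comm]
  rw [Q_apply, Q_apply]
  simp only [h]
  split_ifs with h1
  · rw [eps, eps, Prod.fst_swap, Prod.fst_swap, h1.1, h1.2, sgn_neg_mul]
  · rfl

/-- Q has rank one and entries ±1 on pairs (c, −c), so summing over no index at all already
reproduces Q. -/
theorem Q_mul_Q_apply (a b : G.Idx × G.Idx) (c : G.Idx) :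
    G.Q a (c, -c) * G.Q (c, -c) b = G.Q a b := by
  simp only [Q_apply, and_true, true_and]
  by_cases ha : a.2 = -a.1
  · by_cases hb : b.2 = -b.1
    · rw [if_pos ha, if_pos hb, if_pos ⟨ha, hb⟩, eps, eps, eps]
      linear_combination G.sgn a.1 * G.sgn b.1 * G.sgn_mul_self c
    · simp [hb]
  · simp [ha]

theorem sum_mul_QMap_snd (f : G.Idx → R) (a : G.Idx) (b : G.Idx × G.Idx) :
    ∑ e, f e * G.QMap R (a, e) b = f (-a) * G.QMap R (a, -a) b := by
  refine Finset.sum_eq_single _ (fun e _ he => ?_) (by simp)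
  rw [QMap_apply, Q_apply, if_neg (fun h => he h.1), map_zero, mul_zero]

theorem sum_mul_QMap_fst (f : G.Idx → R) (a : G.Idx) (b : G.Idx × G.Idx) :
    ∑ e, f e * G.QMap R (e, a) b = f (-a) * G.QMap R (-a, a) b := by
  refine Finset.sum_eq_single _ (fun e _ he => ?_) (by simp)
  rw [QMap_apply, Q_apply, if_neg (fun h : a = -e ∧ b.2 = -b.1 => he (by rw [h.1, neg_neg_idx])),
    map_zero, mul_zero]

theorem sum_QMap_snd_mul (f : G.Idx → R) (a : G.Idx × G.Idx) (b : G.Idx) :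
    ∑ e, G.QMap R a (b, e) * f e = G.QMap R a (b, -b) * f (-b) := by
  refine Finset.sum_eq_single _ (fun e _ he => ?_) (by simp)
  rw [QMap_apply, Q_apply, if_neg (fun h => he h.2), map_zero, zero_mul]

theorem sum_QMap_fst_mul (f : G.Idx → R) (a : G.Idx × G.Idx) (b : G.Idx) :
    ∑ e, G.QMap R a (e, b) * f e = G.QMap R a (-b, b) * f (-b) := by
  refine Finset.sum_eq_single _ (fun e _ he => ?_) (by simp)
  rw [QMap_apply, Q_apply, if_neg (fun h : a.2 = -a.1 ∧ b = -e => he (by rw [h.2, neg_neg_idx])),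
    map_zero, zero_mul]

variable {G}

/-- The matrix `∑_ij E_ij ⊗ F_ji`. -/
def transposeMatrix (F : G.Idx → G.Idx → R) : Matrix G.Idx G.Idx R := Matrix.of fun i j => F j i

variable {F : G.Idx → G.Idx → R}

/-- Q projects onto the line of the invariant tensor, so an operator on the second leg moves to its
adjoint on the first, and the F's are skew-adjoint. -/
theorem one_kronecker_mul_QMap (hF : ∀ i j, F i j = -(G.eps i j • F (-j) (-i))) :
    Matrix.kronecker (1 : Matrix G.Idx G.Idx R) (transposeMatrix F) * G.QMap R =
      -(Matrix.kronecker (transposeMatrix F) (1 : Matrix G.Idx G.Idx R) * G.QMap R) := by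
  ext a b
  rw [one_kronecker_mul_apply, sum_mul_QMap_snd, Matrix.neg_apply, kronecker_one_mul_apply,
    sum_mul_QMap_fst]
  simp only [transposeMatrix, Matrix.of_apply, QMap_apply, Q_apply, neg_neg_idx]
  rw [hF (-a.1) a.2, neg_neg_idx]
  split_ifs
  · rw [neg_mul, smul_mul_assoc, ← Algebra.commutes, ← Algebra.smul_def, ← Algebra.commutes,
      ← Algebra.smul_def, smul_smul]
    congr 2
    simp only [eps, sgn_neg]
    linear_combination 2 * G.eta * G.sgn a.2 * G.sgn b.1 * G.sgn_mul_self a.1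
  all_goals simp_all

theorem QMap_mul_one_kronecker (hF : ∀ i j, F i j = -(G.eps i j • F (-j) (-i))) :
    G.QMap R * Matrix.kronecker (1 : Matrix G.Idx G.Idx R) (transposeMatrix F) =
      -(G.QMap R * Matrix.kronecker (transposeMatrix F) (1 : Matrix G.Idx G.Idx R)) := by
  ext a b
  rw [mul_one_kronecker_apply, sum_QMap_snd_mul, Matrix.neg_apply, mul_kronecker_one_apply,
    sum_QMap_fst_mul]
  simp only [transposeMatrix, Matrix.of_apply, QMap_apply, Q_apply, neg_neg_idx]
  rw [hF b.2 (-b.1), neg_neg_idx]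
  split_ifs
  · rw [mul_neg, mul_smul_comm, ← Algebra.smul_def, ← Algebra.smul_def, smul_smul]
    congr 2
    simp only [eps, sgn_neg]
    linear_combination 2 * G.eta * G.sgn b.2 * G.sgn a.1 * G.sgn_mul_self b.1
  all_goals simp_all

theorem kronecker_commutator
    (hF : ∀ a b c d, F c a * F d b - F d b * F c a =
      (((if a = d then (1 : ℂ) else 0) • F c b - (if b = c then (1 : ℂ) else 0) • F d a) +
        ((if d = -c then G.eps (-b) c else 0) • F (-b) a)) -
        (if b = -a then G.eps a (-d) else 0) • F c (-d)) :
    Matrix.kronecker (transposeMatrix F) (1 : Matrix G.Idx G.Idx R) * Matrix.kronecker (1 : Matrix G.Idx G.Idx R) (transposeMatrix F) -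
        Matrix.kronecker (1 : Matrix G.Idx G.Idx R) (transposeMatrix F) * Matrix.kronecker (transposeMatrix F) (1 : Matrix G.Idx G.Idx R) =
      flipMatrix G.Idx R * (Matrix.kronecker (transposeMatrix F) (1 : Matrix G.Idx G.Idx R) -
        Matrix.kronecker (1 : Matrix G.Idx G.Idx R) (transposeMatrix F)) +
      (Matrix.kronecker (transposeMatrix F) (1 : Matrix G.Idx G.Idx R) * G.QMap R -
        G.QMap R * Matrix.kronecker (transposeMatrix F) (1 : Matrix G.Idx G.Idx R)) := by
  ext a b
  have h := hF a.1 a.2 b.1 b.2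
  have e1 : (Matrix.kronecker (transposeMatrix F) (1 : Matrix G.Idx G.Idx R) *
      Matrix.kronecker (1 : Matrix G.Idx G.Idx R) (transposeMatrix F)) a b = F b.1 a.1 * F b.2 a.2 := by
    rw [kronecker_one_mul_apply]
    simp [transposeMatrix, Matrix.one_apply]
  have e2 : (Matrix.kronecker (1 : Matrix G.Idx G.Idx R) (transposeMatrix F) *
      Matrix.kronecker (transposeMatrix F) (1 : Matrix G.Idx G.Idx R)) a b = F b.2 a.2 * F b.1 a.1 := by
    rw [one_kronecker_mul_apply]
    simp [transposeMatrix, Matrix.one_apply]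
  rw [Matrix.sub_apply, e1, e2, h, Matrix.add_apply, flipMatrix_mul_apply, Matrix.sub_apply,
    Matrix.sub_apply, kronecker_one_mul_apply, sum_mul_QMap_fst, mul_kronecker_one_apply,
    sum_QMap_fst_mul, ← add_sub_assoc]
  congr 1
  · congr 1
    · simp [transposeMatrix, Matrix.one_apply, ite_smul, eq_comm]
    · simp only [transposeMatrix, Matrix.of_apply, QMap_apply, Q_apply, neg_neg_idx, true_and]
      rw [← Algebra.commutes, ← Algebra.smul_def]
  · simp only [transposeMatrix, Matrix.of_apply, QMap_apply, Q_apply, neg_neg_idx, and_true]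
    rw [← Algebra.smul_def]

theorem leg₂_QMap_mul_leg₂_QMap {q k p : Fin n} (hqk : q ≠ k) (hqp : q ≠ p) (hkp : k ≠ p) :
    leg₂ q p (G.QMap R) * leg₂ k p (G.QMap R) =
      permuteMatrix G.Idx R (Equiv.swap q k) * leg₂ k p (G.QMap R) := by
  ext i j
  rw [leg₂_mul_apply hqp, permuteMatrix_mul_apply]
  -- The right factor forces the intermediate value on leg p to be −i k, and the left factor then
  -- forces the one on leg q to be i k.
  rw [Finset.sum_eq_single (i k, -i k)]
  · have h : ∀ r, r ≠ k → r ≠ p →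
        Function.update (Function.update i q (i k)) p (-i k) r = (i ∘ Equiv.swap q k) r := by
      intro r hk hp
      rw [Function.update_of_ne hp, Function.comp_apply]
      by_cases hq : r = q
      · rw [hq, Function.update_self, Equiv.swap_apply_left]
      · rw [Function.update_of_ne hq, Equiv.swap_apply_of_ne_of_ne hq hk]
    have hc : (∀ r, r ≠ k → r ≠ p →
        Function.update (Function.update i q (i k)) p (-i k) r = j r) ↔
        ∀ r, r ≠ k → r ≠ p → (i ∘ Equiv.swap q k) r = j r :=
      forall_congr' fun r => forall_congr' fun hk => forall_congr' fun hp => by rw [h r hk hp]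
    simp only [leg₂, Matrix.of_apply, hc, mul_ite, mul_zero]
    refine if_congr Iff.rfl ?_ rfl
    rw [Function.update_of_ne hkp, Function.update_of_ne hqk.symm, Function.update_self,
      Function.comp_apply, Function.comp_apply, Equiv.swap_apply_right,
      Equiv.swap_apply_of_ne_of_ne hqp.symm hkp.symm, QMap_apply, QMap_apply, QMap_apply, ← map_mul,
      Q_mul_Q_apply]
  · intro a _ ha
    simp only [leg₂, Matrix.of_apply, mul_ite, mul_zero]
    rw [Function.update_of_ne hkp, Function.update_of_ne hqk.symm, Function.update_self,
      QMap_apply, QMap_apply, ← map_mul, Q_apply, Q_apply]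
    have h0 : ¬ ((i p = -i q ∧ a.2 = -a.1) ∧ (a.2 = -i k ∧ j p = -j k)) := by
      rintro ⟨⟨_, h1⟩, h2, _⟩
      refine ha (Prod.ext ?_ h2)
      rw [← G.neg_neg_idx a.1, ← h1, h2, neg_neg_idx]
    rw [ite_mul, zero_mul, mul_ite, mul_zero, ← ite_and, if_neg h0, map_zero, ite_self]
  · simp

theorem brauerRelations {K : Type*} [Field K] [Algebra ℂ K] [Algebra K R] [IsScalarTower ℂ K R]
    (P : Equiv.Perm (Fin n) →* Matrix (Fin n → G.Idx) (Fin n → G.Idx) R)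
    (hP : ∀ σ, P σ = permuteMatrix G.Idx R σ)
    (hF : ∀ i j, F i j = -(G.eps i j • F (-j) (-i)))
    (hF' : ∀ a b c d, F c a * F d b - F d b * F c a =
      (((if a = d then (1 : ℂ) else 0) • F c b - (if b = c then (1 : ℂ) else 0) • F d a) +
        ((if d = -c then G.eps (-b) c else 0) • F (-b) a)) -
        (if b = -a then G.eps a (-d) else 0) • F c (-d)) :
    BrauerRelations P (fun p q => leg₂ p q (G.QMap R)) (fun p => leg p (transposeMatrix F))
      (algebraMap ℂ K G.eta) where
  perm_mul_Q σ p q := by rw [hP, permuteMatrix_mul_leg₂]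
  perm_mul_E σ p := by rw [hP, leg_eq_leg₂_self, permuteMatrix_mul_leg₂, leg_eq_leg₂_self]
  Q_symm p q _ := by
    ext i j
    simp only [leg₂, Matrix.of_apply, QMap_apply]
    refine if_congr ⟨fun h r a b => h r b a, fun h r a b => h r b a⟩ ?_ rfl
    exact congrArg _ (G.Q_swap_swap (i q, i p) (j q, j p))
  Q_mul_Q q k p h1 h2 h3 := by rw [hP, leg₂_QMap_mul_leg₂_QMap h1 h2 h3]
  swap_mul_Q p q h := by
    rw [hP, permuteMatrix_swap, leg₂_mul h, flipMatrix_mul_QMap, leg₂_smul, ← map_ofNat (algebraMap ℂ K) 2,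
      ← map_mul, algebraMap_smul]
  Q_comm_Q p q r s h1 h2 h3 h4 := leg₂_commute h1 h2 h3 h4 fun _ _ _ _ => Algebra.commutes _ _
  Q_comm_E p q r h1 h2 := by
    rw [leg_eq_leg₂_self]
    exact leg₂_commute h1 h1 h2 h2 fun _ _ _ _ => Algebra.commutes _ _
  E_mul_Q p q h := by
    rw [leg_eq_leg₂_left h, leg_eq_leg₂_right h, leg₂_mul h, leg₂_mul h, one_kronecker_mul_QMap hF,
      leg₂_neg]
  Q_mul_E p q h := by
    rw [leg_eq_leg₂_left h, leg_eq_leg₂_right h, leg₂_mul h, leg₂_mul h, QMap_mul_one_kronecker hF,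
      leg₂_neg]
  E_comm p q h := by
    rw [hP, permuteMatrix_swap, leg_eq_leg₂_left h, leg_eq_leg₂_right h]
    simp only [leg₂_mul h, ← leg₂_sub, ← leg₂_add]
    rw [kronecker_commutator hF']
  eta_sq := by
    rw [← map_ofNat (algebraMap ℂ K) 2, ← map_mul, ← map_mul, two_eta_sq, map_one]

end ClassicalGroup

/-! ### Specialization to rational functions with values in U(𝔤) -/

theorem filter_lt_finRange {n : ℕ} (p : Fin n) :
    ((List.finRange n).filter fun q => q < p) = (List.finRange n).take p := by
  conv_lhs => rw [← List.take_append_drop (p : ℕ) (List.finRange n)]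
  rw [List.filter_append, List.filter_eq_self.2, List.filter_eq_nil_iff.2, List.append_nil]
  · intro q hq
    obtain ⟨i, hi, rfl⟩ := List.mem_drop_iff_getElem.1 hq
    simp [Fin.lt_def]
  · intro q hq
    simpa using BrauerRelations.mem_take_finRange hq

theorem RatFunc.X_add_X_add_C_ne_zero (z : ℂ) : (RatFunc.X + RatFunc.X + RatFunc.C z : RatFunc ℂ) ≠ 0 := by
  have h : (RatFunc.X + RatFunc.X + RatFunc.C z : RatFunc ℂ) =
      algebraMap (Polynomial ℂ) (RatFunc ℂ) (Polynomial.X + Polynomial.X + Polynomial.C z) := by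
    simp
  rw [h]
  refine RatFunc.algebraMap_ne_zero fun h0 => ?_
  have := congrArg (fun p => Polynomial.coeff p 1) h0
  simp at this

namespace ClassicalGroup

variable (G : ClassicalGroup) {n : ℕ}

/-- The permutations of tensor factors with coefficients extended. -/
noncomputable def permuteHom (n : ℕ) :
    Equiv.Perm (Fin n) →* Matrix (Fin n → G.Idx) (Fin n → G.Idx) G.Coeff :=
  ((algebraMap ℂ G.Coeff).mapMatrix : Matrix (Fin n → G.Idx) (Fin n → G.Idx) ℂ →+* _).toMonoidHom.comp
    (permuteFactors G.Idx n)

theorem permuteHom_apply (σ : Equiv.Perm (Fin n)) :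
    G.permuteHom n σ = permuteMatrix G.Idx G.Coeff σ := by
  ext i j
  change algebraMap ℂ G.Coeff (if _ then 1 else 0) = if _ then 1 else 0
  split_ifs
  · exact map_one _
  · exact map_zero _

/-- The copies of `F_ij` in the coefficient algebra. -/
noncomputable def FCoeff (i j : G.Idx) : G.Coeff := (1 : RatFunc ℂ) ⊗ₜ[ℂ] G.FGen i j

theorem brauerRelations_coeff (n : ℕ) :
    BrauerRelations (G.permuteHom n) (fun p q => leg₂ p q (G.QMap G.Coeff))
      (fun p => leg p (transposeMatrix G.FCoeff)) (RatFunc.C G.eta) := by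
  have := brauerRelations (K := RatFunc ℂ) (F := G.FCoeff) (G.permuteHom n) G.permuteHom_apply
    (fun i j => by
      unfold FCoeff
      rw [G.FGen_neg_neg i j, TensorProduct.tmul_neg, TensorProduct.tmul_smul])
    (fun a b c d => by
      unfold FCoeff
      rw [Algebra.TensorProduct.tmul_mul_tmul, Algebra.TensorProduct.tmul_mul_tmul, one_mul,
        ← TensorProduct.tmul_sub, G.FGen_commutator, TensorProduct.tmul_sub, TensorProduct.tmul_add,
        TensorProduct.tmul_sub]
      simp only [TensorProduct.tmul_smul])
  exact this

theorem leg_F (a : RatFunc ℂ) (p : Fin n) :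
    leg p (G.F a) =
      BrauerRelations.FMat (fun p => leg p (transposeMatrix G.FCoeff)) (RatFunc.C G.eta) a p := by
  have : (∑ i, ∑ j, Matrix.single i j ((1 : RatFunc ℂ) ⊗ₜ[ℂ] G.FGen j i)) =
      transposeMatrix G.FCoeff := (Matrix.matrix_eq_sum_single _).symm
  rw [F, this, leg_add, leg_smul, leg_one]
  rfl

theorem tensorOne_leg₂_Q (p q : Fin n) : G.tensorOne (leg₂ p q G.Q) = leg₂ p q (G.QMap G.Coeff) :=
  leg₂_map _ (map_zero _) p q G.Q

theorem tensorOne_leg₂_RTilde (a b : RatFunc ℂ) {p q : Fin n} (hpq : p ≠ q) :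
    G.tensorOne (leg₂ p q (G.RTilde a b)) =
      BrauerRelations.RMat (fun p q => leg₂ p q (G.QMap G.Coeff)) a b p q := by
  have h : leg₂ p q (G.RTilde a b) =
      1 + (a + b)⁻¹ • leg₂ p q (G.Q.map (algebraMap ℂ (RatFunc ℂ))) := by
    rw [RTilde, leg₂_add, leg₂_smul, leg₂_one hpq]
  rw [h, BrauerRelations.RMat, tensorOne]
  have h2 : (leg₂ p q (G.Q.map (algebraMap ℂ (RatFunc ℂ)))).map (algebraMap (RatFunc ℂ) G.Coeff) =
      leg₂ p q (G.QMap G.Coeff) := by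
    rw [leg₂_map _ (map_zero _)]
    rfl
  have h3 : ∀ (s : RatFunc ℂ) (M : Matrix (Fin n → G.Idx) (Fin n → G.Idx) (RatFunc ℂ)),
      (s • M).map (algebraMap (RatFunc ℂ) G.Coeff) =
        s • M.map (algebraMap (RatFunc ℂ) G.Coeff) := by
    intro s M
    ext i j
    rw [Matrix.map_apply, Matrix.smul_apply, Matrix.smul_apply, Matrix.map_apply, smul_eq_mul,
      map_mul, Algebra.smul_def]
  rw [Matrix.map_add _ (map_add _), h3, h2, Matrix.map_one _ (map_zero _) (map_one _)]

/-- The operator of the matrix element `∑_σ ⟨w, σ w'⟩ σ`, as a function of `w'`. -/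
noncomputable def matrixElement {W : Type*} [NormedAddCommGroup W] [InnerProductSpace ℂ W]
    (ρ : Representation ℂ (Equiv.Perm (Fin n)) W) (w : W) :
    W →+ Matrix (Fin n → G.Idx) (Fin n → G.Idx) G.Coeff :=
  AddMonoidHom.mk' (fun w' => ∑ σ : Equiv.Perm (Fin n),
    RatFunc.C (((Module.finrank ℂ W : ℂ) / (n.factorial : ℂ)) * inner ℂ w (ρ σ w')) •
      G.permuteHom n σ) fun x y => by
    simp only [map_add, inner_add_right, mul_add, add_smul, Finset.sum_add_distrib]

variable {W : Type*} [NormedAddCommGroup W] [InnerProductSpace ℂ W]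
  (ρ : Representation ℂ (Equiv.Perm (Fin n)) W) (w : W)

theorem matrixElement_apply (w' : W) : G.matrixElement ρ w w' = ∑ σ : Equiv.Perm (Fin n),
    RatFunc.C (((Module.finrank ℂ W : ℂ) / (n.factorial : ℂ)) * inner ℂ w (ρ σ w')) •
      G.permuteHom n σ := rfl

theorem tensorOne_Y : G.tensorOne (G.Y ρ w) = G.matrixElement ρ w w := by
  have h : ∀ (z : ℂ) (σ : Equiv.Perm (Fin n)), (algebraMap ℂ G.Coeff).mapMatrix
      (z • permuteFactors G.Idx n σ) = RatFunc.C z • G.permuteHom n σ := by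
    intro z σ
    ext i j
    rw [RingHom.mapMatrix_apply, Matrix.map_apply, Matrix.smul_apply, Matrix.smul_apply,
      smul_eq_mul, map_mul, ← RatFunc.algebraMap_eq_C, algebraMap_smul, Algebra.smul_def]
    rfl
  change (algebraMap ℂ G.Coeff).mapMatrix (G.Y ρ w) = _
  rw [Y, diagonalMatrixElement, map_sum, map_sum, matrixElement_apply]
  refine Finset.sum_congr rfl fun σ _ => ?_
  rw [MonoidAlgebra.lift_single, h]

/-- Reindexing by σ ↦ στ converts right multiplication by a permutation into the action on w'. This
is how eigenvalues on the vector become eigenvalues on the operator. -/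
theorem matrixElement_mul (w' : W) (τ : Equiv.Perm (Fin n)) :
    G.matrixElement ρ w (ρ τ w') * G.permuteHom n τ = G.matrixElement ρ w w' := by
  rw [matrixElement_apply, matrixElement_apply, Finset.sum_mul]
  refine Finset.sum_equiv (Equiv.mulRight τ) (by simp) fun σ _ => ?_
  rw [smul_mul_assoc, Equiv.coe_mulRight, ← map_mul, ← Module.End.mul_apply, ← map_mul]

theorem matrixElement_smul (w' : W) (z : ℂ) :
    G.matrixElement ρ w (z • w') = RatFunc.C z • G.matrixElement ρ w w' := by
  rw [matrixElement_apply, matrixElement_apply, Finset.smul_sum]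
  refine Finset.sum_congr rfl fun σ _ => ?_
  rw [smul_smul, ← map_mul, map_smul, inner_smul_right]
  congr 2
  ring

end ClassicalGroup

theorem proposition2p6 (G : ClassicalGroup) {n : ℕ} {ν : YoungDiagram}
    (hν : ν.colLen 0 ≤ G.dim) (T : StandardTableau ν n)
    {W : Type*} [NormedAddCommGroup W] [InnerProductSpace ℂ W]
    (ρ : Representation ℂ (Equiv.Perm (Fin n)) W) (hρ : IsIrrepOfShape ρ ν)
    (hinv : ∀ (σ : Equiv.Perm (Fin n)) (x y : W), inner ℂ (ρ σ x) (ρ σ y) = inner ℂ x y)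
    (w : W) (hw : IsYoungVector T ρ w) :
    G.FT T ρ w =
      G.tensorOne (G.Y ρ w) *
        ((List.finRange n).map fun p =>
          (((List.finRange n).filter fun q => q < p).map fun q =>
            G.tensorOne (leg₂ q p
              (G.RTilde (ClassicalGroup.shift T q) (ClassicalGroup.shift T p)))).prod *
            leg p (G.F (ClassicalGroup.shift T p))).prod := by
  -- Contents enter as real numbers embedded into ℂ(u) as constants, and u is the variable, so no
  -- denominator 2u + r vanishes.
  have key := (G.brauerRelations_coeff n).map_mul_prod_sumFactor
    (f := RatFunc.C.comp Complex.ofRealHom) (u := RatFunc.X)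
    (fun r => RatFunc.X_add_X_add_C_ne_zero r) hinv (fun σ w' => G.matrixElement_mul ρ w w' σ)
    (fun r w' => G.matrixElement_smul ρ w w' r) (fun p => (T.content p : ℝ)) w
    hw.jucysMurphy_apply
  have hs : ∀ p, ClassicalGroup.shift T p =
      RatFunc.X + (RatFunc.C.comp Complex.ofRealHom) (T.content p : ℝ) := by
    intro p
    simp [ClassicalGroup.shift]
  rw [ClassicalGroup.FT, G.tensorOne_Y]
  refine Eq.trans (congrArg (fun l => G.matrixElement ρ w w * List.prod l)
    (List.map_congr_left fun p _ => ?_)) (key.trans (congrArg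
      (fun l => G.matrixElement ρ w w * List.prod l) (List.map_congr_left fun p _ => ?_)).symm)
  · rw [BrauerRelations.sumFactor, G.leg_F, hs, two_mul, add_assoc]
    simp only [G.tensorOne_leg₂_Q]
    simp
  · rw [BrauerRelations.RProd, G.leg_F, filter_lt_finRange, hs]
    congr 2
    refine List.map_congr_left fun q hq => ?_
    have hq : q < p := BrauerRelations.mem_take_finRange hq
    rw [G.tensorOne_leg₂_RTilde _ _ hq.ne, hs]
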